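/- All graphs are finite, simple and undirected. For a graph $G$ of order $n\ge 1$ with non-increasing degree sequence $d_1\ge d_2\ge\dots\ge d_n$, let $\gamma(G)$ be its domination number, that is, the minimum order of a set $D\subseteq V(G)$ such that every vertex in $V(G)\setminus D$ has a neighbor in $D$, and let $$s\ell(G)=\min\Big\{s\ge 1 : (d_1+1)+\cdots+(d_s+1)\ge n\Big\}$$ be its Slater number. **Theorem.** There is a deterministic polynomial-time algorithm that, for every given graph $G$ of order $n\ge 1$ (given by its adjacency matrix), correctly decides for one of the following two statements, that is, it outputs one of them, and the statement that it outputs is true for $G$: 1. $\gamma(G)>s\ell(G)$; 2. $\gamma(G)\le \left(\left\lceil \ln\left(\frac{n}{s\ell(G)}\right)\right\rceil+1\right)s\ell(G)$. -/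

import Mathlib

/-- `D` is a dominating set of `G`: every vertex outside `D` has a neighbor in `D`. -/
def SimpleGraph.IsDominating {V : Type*} (G : SimpleGraph V) (D : Finset V) : Prop :=
  ∀ v, v ∉ D → ∃ u ∈ D, G.Adj v u

/-- The domination number: the minimum order of a dominating set. The set of orders is never
empty, because the set of all vertices is dominating. -/
noncomputable def SimpleGraph.dominationNumber {V : Type*} [Fintype V] (G : SimpleGraph V) : ℕ :=
  sInf {k : ℕ | ∃ D : Finset V, G.IsDominating D ∧ D.card = k}

open Classical in
/-- The non-increasing degree sequence `d₁ ≥ d₂ ≥ ⋯ ≥ dₙ`. -/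
noncomputable def SimpleGraph.degreeSeq {V : Type*} [Fintype V] (G : SimpleGraph V) : List ℕ :=
  ((Finset.univ : Finset V).val.map fun v => G.degree v).sort (· ≥ ·)

/-- The Slater number: the least positive integer `s` with
`(d₁ + 1) + ⋯ + (dₛ + 1) ≥ n`. For `n ≥ 1` the set contains `s = n`. -/
noncomputable def SimpleGraph.slaterNumber {V : Type*} [Fintype V] (G : SimpleGraph V) : ℕ :=
  sInf {s : ℕ | 1 ≤ s ∧ Fintype.card V ≤ ((G.degreeSeq.take s).map fun d => d + 1).sum}

/-- Instances: finite simple graphs with vertex set `{0, …, n - 1}`. -/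
abbrev GraphInstance : Type := Σ n : ℕ, SimpleGraph (Fin n)

open Classical in
/-- A graph is presented to the machine by its adjacency matrix, row by row, over the three-letter
alphabet `Option Bool`: the entries are `some true` and `some false`, and each row is followed by
the separator `none`. A graph of order `n` thus has an encoding of length `n * (n + 1)`. -/
noncomputable def encodeGraph (G : GraphInstance) : List (Option Bool) :=
  (List.finRange G.1).flatMap fun i =>
    ((List.finRange G.1).map fun j => some (decide (G.2.Adj i j))) ++ [none]

theorem encodeGraph_length (G : GraphInstance) :
    (encodeGraph G).length = G.1 * (G.1 + 1) := by
  simp [encodeGraph, List.length_flatMap]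

theorem encodeGraph_injective : Function.Injective encodeGraph := by
  rintro ⟨n, G⟩ ⟨m, H⟩ h
  have hl := congrArg List.length h
  rw [encodeGraph_length, encodeGraph_length] at hl
  have hnm : n = m := by
    simp only at hl
    nlinarith [lt_trichotomy n m, Nat.zero_le n, Nat.zero_le m]
  subst hnm
  congr 1
  have key : ∀ (l : List (Fin n)) (f g : Fin n → List (Option Bool)),
      (∀ i, (f i).length = (g i).length) → l.flatMap f = l.flatMap g → ∀ i ∈ l, f i = g i := by
    intro l f g hfg
    induction l with
    | nil => simp
    | cons a l ih =>
      intro he i hi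
      rw [List.flatMap_cons, List.flatMap_cons] at he
      obtain ⟨h1, h2⟩ := List.append_inj he (hfg a)
      rcases List.mem_cons.1 hi with rfl | hi
      · exact h1
      · exact ih h2 i hi
  ext i j
  have hi := key (List.finRange n) _ _ (by simp) h i (List.mem_finRange i)
  have hi := List.append_cancel_right hi
  have hj := List.map_inj_left.1 hi j (List.mem_finRange j)
  simpa using hj

/-! Write s for the Slater number and u for the current number of undominated vertices. The
algorithm passes over the vertices and selects a vertex whenever it dominates at least u/s of the
undominated ones. If a whole pass changes nothing while u > 0, every closed neighborhood contains
fewer than u/s undominated vertices. A dominating set must cover all u of them, so it has more than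
s elements (`lt_dominationNumber`). Otherwise everything gets dominated. Each selection multiplies u
by at most 1 - 1/s, so K = s⌈ln(n/s)⌉ selections leave at most n·exp(-K/s) ≤ s vertices, and each
later selection removes at least one. Hence at most K + s vertices are selected (`GreedyBound.step`,
`mul_one_sub_pow_le`). A pass that is not stationary enlarges the dominated set, so n passes suffice
(`iterate_greedy_eq_univ_or`). The Slater number enters only through 1 ≤ s ≤ n and through being
computable.

Polynomial time is obtained from a small language of counters and one array of fixed length B, in
which every loop makes at most B rounds. By induction on the program, counters grow by at most G(B),
whatever their initial values, so nesting a loop only multiplies this growth by B and all costs stay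
polynomial (`exists_exec_compile`). Such programs are compiled to structured stack programs and
these to `TM2` machines (`StackProg.Exec.reaches`). The algorithm is a counter program whose array
is the adjacency matrix with a mark on each cell; its correctness is a matter of loop invariants
(`iterate_induction`). -/

/-! ### Structured programs over stacks, compiled to `TM2` machines -/

/-- Structured programs acting on a family of stacks and a finite control state. -/
inductive StackProg {K : Type} (Γ : K → Type) (σ : Type) : Type
  | push (k : K) (f : σ → Γ k)
  | pop (k : K) (f : σ → Option (Γ k) → σ)
  | load (f : σ → σ)
  | seq (p q : StackProg Γ σ)
  | ite (b : σ → Bool) (p q : StackProg Γ σ)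
  | loop (b : σ → Bool) (p : StackProg Γ σ)

namespace StackProg

variable {K : Type} {Γ : K → Type} {σ : Type}

/-- `Exec p v S v' S' n`: started in control state `v` with stacks `S`, the program `p` ends in
control state `v'` with stacks `S'` after at most `n` steps. -/
inductive Exec [DecidableEq K] : StackProg Γ σ → σ → (∀ k, List (Γ k)) → σ → (∀ k, List (Γ k)) →
    ℕ → Prop
  | push {k f v S n} (hn : 1 ≤ n) :
      Exec (.push k f) v S v (Function.update S k (f v :: S k)) n
  | pop {k f v S n} (hn : 1 ≤ n) :
      Exec (.pop k f) v S (f v (S k).head?) (Function.update S k (S k).tail) n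
  | load {f v S n} (hn : 1 ≤ n) : Exec (.load f) v S (f v) S n
  | seq {p q v₁ S₁ v₂ S₂ v₃ S₃ n₁ n₂ n} (h₁ : Exec p v₁ S₁ v₂ S₂ n₁) (h₂ : Exec q v₂ S₂ v₃ S₃ n₂)
      (hn : n₁ + n₂ ≤ n) : Exec (.seq p q) v₁ S₁ v₃ S₃ n
  | ite_true {b p q v S v' S' m n} (hb : b v = true) (h : Exec p v S v' S' m) (hn : m + 1 ≤ n) :
      Exec (.ite b p q) v S v' S' n
  | ite_false {b p q v S v' S' m n} (hb : b v = false) (h : Exec q v S v' S' m) (hn : m + 1 ≤ n) :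
      Exec (.ite b p q) v S v' S' n
  | loop_false {b p v S n} (hb : b v = false) (hn : 1 ≤ n) : Exec (.loop b p) v S v S n
  | loop_true {b p v₁ S₁ v₂ S₂ v₃ S₃ n₁ n₂ n} (hb : b v₁ = true) (h₁ : Exec p v₁ S₁ v₂ S₂ n₁)
      (h₂ : Exec (.loop b p) v₂ S₂ v₃ S₃ n₂) (hn : n₁ + n₂ + 1 ≤ n) :
      Exec (.loop b p) v₁ S₁ v₃ S₃ n

/-- The labels of the machine code of a program. -/
def Lab : StackProg Γ σ → Type
  | .push _ _ => Unit
  | .pop _ _ => Unit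
  | .load _ => Unit
  | .seq p q => Lab p ⊕ Lab q
  | .ite _ p q => Option (Lab p ⊕ Lab q)
  | .loop _ p => Option (Lab p)

instance finite_lab : (p : StackProg Γ σ) → Finite (Lab p)
  | .push _ _ => inferInstanceAs (Finite Unit)
  | .pop _ _ => inferInstanceAs (Finite Unit)
  | .load _ => inferInstanceAs (Finite Unit)
  | .seq p q =>
    have := finite_lab p
    have := finite_lab q
    inferInstanceAs (Finite (Lab p ⊕ Lab q))
  | .ite _ p q =>
    have := finite_lab p
    have := finite_lab q
    inferInstanceAs (Finite (Option (Lab p ⊕ Lab q)))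
  | .loop _ p =>
    have := finite_lab p
    inferInstanceAs (Finite (Option (Lab p)))

/-- The label at which the machine code of a program starts. -/
def entry : (p : StackProg Γ σ) → Lab p
  | .push _ _ => ()
  | .pop _ _ => ()
  | .load _ => ()
  | .seq p _ => Sum.inl (entry p)
  | .ite _ _ _ => (none : Option _)
  | .loop _ _ => (none : Option _)

/-- The machine code of a program, whose labels are renamed by `e` and which continues at
`exit`. -/
def code {Λ : Type} : (p : StackProg Γ σ) → (Lab p → Λ) → Λ → Lab p → Turing.TM2.Stmt Γ Λ σ
  | .push k f, _, exit, _ => .push k f (.goto fun _ => exit)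
  | .pop k f, _, exit, _ => .pop k f (.goto fun _ => exit)
  | .load f, _, exit, _ => .load f (.goto fun _ => exit)
  | .seq p q, e, exit, l =>
    Sum.elim (fun l => code p (fun l => e (Sum.inl l)) (e (Sum.inr (entry q))) l)
      (fun l => code q (fun l => e (Sum.inr l)) exit l) l
  | .ite b p q, e, exit, l =>
    Option.elim (α := Lab p ⊕ Lab q) l
      (.branch b (.goto fun _ => e (some (Sum.inl (entry p))))
        (.goto fun _ => e (some (Sum.inr (entry q)))))
      (Sum.elim (fun l => code p (fun l => e (some (Sum.inl l))) exit l)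
        (fun l => code q (fun l => e (some (Sum.inr l))) exit l))
  | .loop b p, e, exit, l =>
    Option.elim (α := Lab p) l
      (.branch b (.goto fun _ => e (some (entry p))) (.goto fun _ => exit))
      (fun l => code p (fun l => e (some l)) (e (none : Option _)) l)

/-- Every primitive is one machine step and `seq` costs nothing, since the code of the first program
exits to the entry of the second. Only the image of `e` is constrained, so the induction applies to
code embedded in a larger machine. A loop body exits to the label of its own loop test. -/
theorem Exec.reaches [DecidableEq K] {p : StackProg Γ σ} {v S v' S' n}
    (h : Exec p v S v' S' n) :
    ∀ {Λ : Type} (M : Λ → Turing.TM2.Stmt Γ Λ σ) (e : Lab p → Λ) (exit : Λ),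
      (∀ l, M (e l) = code p e exit l) →
      ∃ m ≤ n, (flip bind (Turing.TM2.step M))^[m] (some ⟨some (e (entry p)), v, S⟩) =
        some ⟨some exit, v', S'⟩ := by
  induction h with
  | push hn =>
    intro Λ M e exit hM
    refine ⟨1, hn, ?_⟩
    have := hM (entry _)
    simp [flip, this, code]
  | pop hn =>
    intro Λ M e exit hM
    refine ⟨1, hn, ?_⟩
    have := hM (entry _)
    simp [flip, this, code]
  | load hn =>
    intro Λ M e exit hM
    refine ⟨1, hn, ?_⟩
    have := hM (entry _)
    simp [flip, this, code]
  | @seq p q v₁ S₁ v₂ S₂ v₃ S₃ n₁ n₂ n h₁ h₂ hn ih₁ ih₂ =>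
    intro Λ M e exit hM
    obtain ⟨m₁, hm₁, e₁⟩ := ih₁ M (fun l => e (Sum.inl l)) (e (Sum.inr (entry q)))
      (fun l => hM (Sum.inl l))
    obtain ⟨m₂, hm₂, e₂⟩ := ih₂ M (fun l => e (Sum.inr l)) exit (fun l => hM (Sum.inr l))
    refine ⟨m₂ + m₁, by omega, ?_⟩
    rw [Function.iterate_add_apply]
    exact (congrArg _ e₁).trans e₂
  | @ite_true b p q v S v' S' m n hb h hn ih =>
    intro Λ M e exit hM
    obtain ⟨m, hm, e₁⟩ := ih M (fun l => e (some (Sum.inl l))) exit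
      (fun l => hM (some (Sum.inl l)))
    refine ⟨m + 1, by omega, ?_⟩
    rw [Function.iterate_add_apply]
    refine Eq.trans (congrArg _ ?_) e₁
    have hc : M (e (none : Option _)) = .branch b (.goto fun _ => e (some (Sum.inl (entry p))))
        (.goto fun _ => e (some (Sum.inr (entry q)))) := hM (none : Option _)
    change some (Turing.TM2.stepAux (M (e (none : Option _))) _ _) = _
    simp [hc, hb]
  | @ite_false b p q v S v' S' m n hb h hn ih =>
    intro Λ M e exit hM
    obtain ⟨m, hm, e₁⟩ := ih M (fun l => e (some (Sum.inr l))) exit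
      (fun l => hM (some (Sum.inr l)))
    refine ⟨m + 1, by omega, ?_⟩
    rw [Function.iterate_add_apply]
    refine Eq.trans (congrArg _ ?_) e₁
    have hc : M (e (none : Option _)) = .branch b (.goto fun _ => e (some (Sum.inl (entry p))))
        (.goto fun _ => e (some (Sum.inr (entry q)))) := hM (none : Option _)
    change some (Turing.TM2.stepAux (M (e (none : Option _))) _ _) = _
    simp [hc, hb]
  | @loop_false b p v S n hb hn =>
    intro Λ M e exit hM
    refine ⟨1, hn, ?_⟩
    have hc : M (e (none : Option _)) = .branch b (.goto fun _ => e (some (entry p)))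
        (.goto fun _ => exit) := hM (none : Option _)
    change some (Turing.TM2.stepAux (M (e (none : Option _))) _ _) = _
    simp [hc, hb]
  | @loop_true b p v₁ S₁ v₂ S₂ v₃ S₃ n₁ n₂ n hb h₁ h₂ hn ih₁ ih₂ =>
    intro Λ M e exit hM
    obtain ⟨m₁, hm₁, e₁⟩ := ih₁ M (fun l => e (some l)) (e (none : Option _))
      (fun l => hM (some l))
    obtain ⟨m₂, hm₂, e₂⟩ := ih₂ M e exit hM
    refine ⟨m₂ + (m₁ + 1), by omega, ?_⟩
    rw [Function.iterate_add_apply, Function.iterate_add_apply]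
    refine Eq.trans (congrArg _ (Eq.trans (congrArg _ ?_) e₁)) e₂
    have hc : M (e (none : Option _)) = .branch b (.goto fun _ => e (some (entry p)))
        (.goto fun _ => exit) := hM (none : Option _)
    change some (Turing.TM2.stepAux (M (e (none : Option _))) _ _) = _
    simp [hc, hb]

/-- This is the form in which `Turing.initList` and `Turing.haltList` present the stacks. -/
theorem update_nil_eq_dite [DecidableEq K] (k₀ : K) (s : List (Γ k₀)) :
    Function.update (fun _ => []) k₀ s = fun k =>
      @dite (List (Γ k)) (k = k₀) _ (fun h => by rw [h]; exact s) fun _ => [] := by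
  funext k
  by_cases hk : k = k₀
  · subst hk
    simp
  · simp [hk]

/-- The machine that runs a program and halts. -/
noncomputable def machine [DecidableEq K] [Fintype K] [Fintype σ] (k₀ k₁ : K) [Fintype (Γ k₀)]
    (v₀ : σ) (p : StackProg Γ σ) : Turing.FinTM2 :=
  haveI : Fintype (Lab p) := Fintype.ofFinite _
  { K := K
    k₀ := k₀
    k₁ := k₁
    Γ := Γ
    Λ := Option (Lab p)
    main := some (entry p)
    σ := σ
    initialState := v₀
    m := fun l => Option.elim l .halt (code p some none) }

/-- A function computed by a structured program within a polynomial number of steps is polynomial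
time computable. -/
theorem nonempty_computableInPolyTime [DecidableEq K] [Fintype K] [Fintype σ] {k₀ k₁ : K}
    [Fintype (Γ k₀)] (v₀ : σ) (p : StackProg Γ σ) (T : Polynomial ℕ) {α β αΓ βΓ : Type}
    {ea : α → List αΓ} {eb : β → List βΓ} {f : α → β} (h₀ : Γ k₀ ≃ αΓ) (h₁ : Γ k₁ ≃ βΓ)
    (h : ∀ a, Exec p v₀ (Function.update (fun _ => []) k₀ ((ea a).map h₀.symm)) v₀
      (Function.update (fun _ => []) k₁ ((eb (f a)).map h₁.symm)) (T.eval (ea a).length)) :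
    Nonempty (Turing.TM2ComputableInPolyTime ea eb f) := by
  have key : ∀ a, ∃ m ≤ T.eval (ea a).length + 1,
      (flip bind (machine k₀ k₁ v₀ p).step)^[m]
        (some (Turing.initList (machine k₀ k₁ v₀ p) ((ea a).map h₀.symm))) =
        some (Turing.haltList (machine k₀ k₁ v₀ p) ((eb (f a)).map h₁.symm)) := by
    intro a
    obtain ⟨m, hm, e⟩ := (h a).reaches (machine k₀ k₁ v₀ p).m some none (fun l => rfl)
    -- The additional step executes `halt` at the exit label `none`.
    refine ⟨1 + m, by omega, ?_⟩
    rw [Function.iterate_add_apply]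
    refine Eq.trans (congrArg _ (Eq.trans (congrArg _ ?_) e)) ?_
    · exact congrArg (fun S => some (Turing.TM2.Cfg.mk _ _ S)) (update_nil_eq_dite k₀ _).symm
    · exact congrArg (fun S => some (Turing.TM2.Cfg.mk _ _ S)) (update_nil_eq_dite k₁ _)
  refine ⟨⟨⟨machine k₀ k₁ v₀ p, h₀, h₁⟩, T + 1, fun a => ?_⟩⟩
  refine ⟨⟨(key a).choose, (key a).choose_spec.2⟩, ?_⟩
  simpa using (key a).choose_spec.1

end StackProg

/-! ### Counter programs with a bounded array -/

theorem Polynomial.monotone_eval_nat (P : Polynomial ℕ) : Monotone fun x : ℕ => P.eval x := by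
  intro x y h
  simp only [Polynomial.eval_eq_sum, Polynomial.sum]
  exact Finset.sum_le_sum fun i _ => Nat.mul_le_mul_left _ (Nat.pow_le_pow_left h i)

/-- An array cell: an input letter together with a mark. -/
abbrev ArrayCell : Type := Option Bool × Bool

/-- Programs with counters indexed by `ρ` and one array. -/
inductive CounterProg (ρ : Type) : Type
  | nop
  | inc (x : ρ)
  | dec (x : ρ)
  | clr (x : ρ)
  | ifZero (x : ρ) (p q : CounterProg ρ)
  | test (x : ρ) (b : ArrayCell → Bool) (p q : CounterProg ρ)
  | upd (x : ρ) (f : ArrayCell → ArrayCell)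
  | rep (x : ρ) (p : CounterProg ρ)
  | seq (p q : CounterProg ρ)

/-- The memory of a counter program. -/
@[ext] structure CounterMem (ρ : Type) where
  /-- the values of the counters -/
  reg : ρ → ℕ
  /-- the array -/
  arr : List ArrayCell

namespace CounterProg

variable {ρ : Type} [DecidableEq ρ]

/-- The effect of a counter program on the memory. The body of `rep x p` is executed `reg x` times,
but at most once for every array cell. -/
def run : CounterProg ρ → CounterMem ρ → CounterMem ρ
  | .nop, m => m
  | .inc x, m => ⟨Function.update m.reg x (m.reg x + 1), m.arr⟩
  | .dec x, m => ⟨Function.update m.reg x (m.reg x - 1), m.arr⟩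
  | .clr x, m => ⟨Function.update m.reg x 0, m.arr⟩
  | .ifZero x p q, m => if m.reg x = 0 then run p m else run q m
  | .test x b p q, m => if (m.arr[m.reg x]?).any b then run p m else run q m
  | .upd x f, m => ⟨m.reg, m.arr.modify (m.reg x) f⟩
  | .rep x p, m => (run p)^[min (m.reg x) m.arr.length] m
  | .seq p q, m => run q (run p m)

/-- The array length caps every loop, so its invariance gives nested loops one fixed bound. -/
theorem length_arr_run (p : CounterProg ρ) (m : CounterMem ρ) :
    (run p m).arr.length = m.arr.length := by
  induction p generalizing m with
  | nop => rfl
  | inc x => rfl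
  | dec x => rfl
  | clr x => rfl
  | ifZero x p q ihp ihq => rw [run]; split_ifs <;> simp [*]
  | test x b p q ihp ihq => rw [run]; split_ifs <;> simp [*]
  | upd x f => simp [run]
  | seq p q ihp ihq => rw [run, ihq, ihp]
  | rep x p ih =>
    rw [run]
    generalize min (m.reg x) m.arr.length = k
    induction k with
    | zero => rfl
    | succ k ihk => rw [Function.iterate_succ_apply', ih, ihk]

/-- The stacks of the machine simulating a counter program. -/
inductive StackName (ρ : Type) : Type
  | inp | out | arr | buf | tmp | clk
  | reg (x : ρ)
deriving DecidableEq, Fintype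

/-- The stack alphabets of the machine simulating a counter program. -/
abbrev Alphabet : StackName ρ → Type
  | .inp => Option Bool
  | .out => Bool
  | _ => ArrayCell

/-- The control states of the machine simulating a counter program. -/
abbrev Control : Type := Option ArrayCell × Bool

/-- The letter used for unary numbers. -/
def unit : ArrayCell := (none, false)

/-- The letter separating the clocks of nested loops. -/
def sep : ArrayCell := (none, true)

/-- The stacks with given contents; the counters are stored in unary. -/
def stk (i : List (Option Bool)) (o : List Bool) (a b : List ArrayCell) (t : ℕ)
    (c : List ArrayCell) (r : ρ → ℕ) : (k : StackName ρ) → List (Alphabet k)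
  | .inp => i
  | .out => o
  | .arr => a
  | .buf => b
  | .tmp => List.replicate t unit
  | .clk => c
  | .reg x => List.replicate (r x) unit

section stk

variable (i i' : List (Option Bool)) (o : List Bool) (a a' b b' c c' : List ArrayCell) (t t' : ℕ)
  (r : ρ → ℕ)

theorem update_inp : Function.update (stk i o a b t c r) .inp i' = stk i' o a b t c r := by
  funext k; cases k <;> simp [Function.update, stk]

theorem update_arr : Function.update (stk i o a b t c r) .arr a' = stk i o a' b t c r := by
  funext k; cases k <;> simp [Function.update, stk]

theorem update_buf : Function.update (stk i o a b t c r) .buf b' = stk i o a b' t c r := by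
  funext k; cases k <;> simp [Function.update, stk]

theorem update_clk : Function.update (stk i o a b t c r) .clk c' = stk i o a b t c' r := by
  funext k; cases k <;> simp [Function.update, stk]

theorem update_tmp : Function.update (stk i o a b t c r) .tmp (List.replicate t' unit) =
    stk i o a b t' c r := by
  funext k; cases k <;> simp [Function.update, stk]

theorem update_reg (x : ρ) :
    Function.update (stk i o a b t c r) (.reg x) (List.replicate t' unit) =
      stk i o a b t c (Function.update r x t') := by
  funext k
  cases k with
  | reg y => by_cases h : y = x
             · subst h; simp [stk]
             · simp [Function.update, stk, h]
  | _ => simp [Function.update, stk]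

end stk

/-! ### Simulation of counter programs by stack programs, with step counts -/

section exec

open StackProg (Exec)

variable {i : List (Option Bool)} {o : List Bool} {a b c : List ArrayCell} {t : ℕ}
  {r : ρ → ℕ} {v : Control} {x : ρ} {n : ℕ}

theorem _root_.StackProg.Exec.push_eq {K : Type} [DecidableEq K] {Γ : K → Type} {σ : Type} {k : K}
    {f : σ → Γ k} {v : σ} {S S' : ∀ k, List (Γ k)} {n : ℕ} (hn : 1 ≤ n)
    (hS : Function.update S k (f v :: S k) = S') : Exec (.push k f) v S v S' n :=
  hS ▸ .push hn

theorem _root_.StackProg.Exec.pop_eq {K : Type} [DecidableEq K] {Γ : K → Type} {σ : Type} {k : K}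
    {f : σ → Option (Γ k) → σ} {v v' : σ} {S S' : ∀ k, List (Γ k)} {n : ℕ} (hn : 1 ≤ n)
    (hv : f v (S k).head? = v') (hS : Function.update S k (S k).tail = S') :
    Exec (.pop k f) v S v' S' n :=
  hv ▸ hS ▸ .pop hn

/-- Pop letters as long as possible and run a program after each of them. -/
def drain {K : Type} {Γ : K → Type} (k : K) (f : Control → Option (Γ k) → Control)
    (b : Control → Bool) (p : StackProg Γ Control) : StackProg Γ Control :=
  .seq (.pop k f) (.loop b (.seq p (.pop k f)))

theorem exec_drain_stop {K : Type} [DecidableEq K] {Γ : K → Type} {k : K}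
    {f : Control → Option (Γ k) → Control} {b : Control → Bool} {p : StackProg Γ Control}
    {v v' : Control} {S S' : ∀ k, List (Γ k)} {n : ℕ} (h : Exec (.pop k f) v S v' S' 1)
    (hb : b v' = false) (hn : 2 ≤ n) : Exec (drain k f b p) v S v' S' n :=
  .seq h (.loop_false hb le_rfl) hn

/-- The body ends with the next pop, so what remains after one round is again a `drain`. The 2 pays
for the pop and the loop test. -/
theorem exec_drain_next {K : Type} [DecidableEq K] {Γ : K → Type} {k : K}
    {f : Control → Option (Γ k) → Control} {b : Control → Bool} {p : StackProg Γ Control}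
    {v v₁ v₂ v₃ : Control} {S S₁ S₂ S₃ : ∀ k, List (Γ k)} {n n₂ n₃ : ℕ}
    (h : Exec (.pop k f) v S v₁ S₁ 1) (hb : b v₁ = true) (h₂ : Exec p v₁ S₁ v₂ S₂ n₂)
    (h₃ : Exec (drain k f b p) v₂ S₂ v₃ S₃ n₃) (hn : n₂ + n₃ + 2 ≤ n) :
    Exec (drain k f b p) v S v₃ S₃ n := by
  cases h₃ with
  | seq h₄ h₅ hn₃ => exact .seq h (.loop_true hb (.seq h₂ h₄ le_rfl) h₅ le_rfl) (by omega)

/-- Keep the popped letter in the control state. -/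
def keep (v : Control) (s : Option ArrayCell) : Control := (s, v.2)

/-- Whether the control state holds a letter. -/
def holds (v : Control) : Bool := v.1.isSome

/-- The letter in the control state. -/
def held (v : Control) : ArrayCell := v.1.getD unit

omit [DecidableEq ρ] in
theorem stk_reg_succ {m : ℕ} (h : r x = m + 1) :
    stk i o a b t c r (.reg x) = unit :: List.replicate m unit := by
  simp [stk, h, List.replicate_succ]

theorem exec_popReg_zero (h : r x = 0) (hn : 1 ≤ n) :
    Exec (.pop (.reg x) keep) v (stk i o a b t c r) (none, v.2) (stk i o a b t c r) n :=
  .pop_eq hn (by simp [stk, h, keep]) (by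
    rw [show (stk i o a b t c r (.reg x)).tail = List.replicate 0 unit by simp [stk, h],
      update_reg, ← h, Function.update_eq_self])

theorem exec_popReg_succ {m : ℕ} (h : r x = m + 1) (hn : 1 ≤ n) :
    Exec (.pop (.reg x) keep) v (stk i o a b t c r) (some unit, v.2)
      (stk i o a b t c (Function.update r x m)) n :=
  .pop_eq hn (by simp [stk_reg_succ h, keep]) (by
    rw [stk_reg_succ h, List.tail_cons, update_reg])

theorem exec_pushReg (hn : 1 ≤ n) :
    Exec (.push (.reg x) fun _ => unit) v (stk i o a b t c r) v
      (stk i o a b t c (Function.update r x (r x + 1))) n :=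
  .push_eq hn (by rw [← update_reg]; rfl)

theorem exec_popTmp_zero (hn : 1 ≤ n) :
    Exec (.pop .tmp keep) v (stk i o a b 0 c r) (none, v.2) (stk i o a b 0 c r) n :=
  .pop_eq hn (by simp [stk, keep]) (update_tmp i o a b c 0 0 r)

theorem exec_popTmp_succ (hn : 1 ≤ n) :
    Exec (.pop .tmp keep) v (stk i o a b (t + 1) c r) (some unit, v.2)
      (stk i o a b t c r) n :=
  .pop_eq hn (by simp [stk, keep, List.replicate_succ]) (update_tmp i o a b c (t + 1) t r)

theorem exec_pushTmp (hn : 1 ≤ n) :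
    Exec (.push .tmp fun _ => unit) v (stk i o a b t c r) v (stk i o a b (t + 1) c r) n :=
  .push_eq hn (update_tmp i o a b c t (t + 1) r)

theorem exec_popArr (hn : 1 ≤ n) :
    Exec (.pop .arr keep) v (stk i o a b t c r) (a.head?, v.2) (stk i o a.tail b t c r) n :=
  .pop_eq hn rfl (update_arr ..)

theorem exec_pushArr {f : Control → ArrayCell} (hn : 1 ≤ n) :
    Exec (.push .arr f) v (stk i o a b t c r) v (stk i o (f v :: a) b t c r) n :=
  .push_eq hn (update_arr ..)

theorem exec_popBuf (hn : 1 ≤ n) :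
    Exec (.pop .buf keep) v (stk i o a b t c r) (b.head?, v.2) (stk i o a b.tail t c r) n :=
  .pop_eq hn rfl (update_buf ..)

theorem exec_pushBuf {f : Control → ArrayCell} (hn : 1 ≤ n) :
    Exec (.push .buf f) v (stk i o a b t c r) v (stk i o a (f v :: b) t c r) n :=
  .push_eq hn (update_buf ..)

theorem exec_popClk (hn : 1 ≤ n) :
    Exec (.pop .clk keep) v (stk i o a b t c r) (c.head?, v.2) (stk i o a b t c.tail r) n :=
  .pop_eq hn rfl (update_clk ..)

theorem exec_pushClk {f : Control → ArrayCell} (hn : 1 ≤ n) :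
    Exec (.push .clk f) v (stk i o a b t c r) v (stk i o a b t (f v :: c) r) n :=
  .push_eq hn (update_clk ..)

theorem exec_clr {m : ℕ} (h : r x = m) (hn : 3 * m + 2 ≤ n) :
    Exec (drain (.reg x) keep holds (.load id)) v (stk i o a b t c r) (none, v.2)
      (stk i o a b t c (Function.update r x 0)) n := by
  induction m generalizing r v n with
  | zero =>
    rw [← h, Function.update_eq_self]
    exact exec_drain_stop (exec_popReg_zero h le_rfl) rfl (by omega)
  | succ m ih =>
    refine exec_drain_next (exec_popReg_succ h le_rfl) rfl (.load le_rfl) (n₃ := 3 * m + 2) ?_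
      (by omega)
    simpa using ih (r := Function.update r x m) (v := (some unit, v.2)) (by simp) le_rfl

/-- Move the array cells before position `reg x` to the buffer and the counter to `tmp`; set
the clock if `w` is true. -/
def scan (x : ρ) (w : Bool) : StackProg (Alphabet (ρ := ρ)) Control :=
  drain (.reg x) keep holds <|
    .seq (.push .tmp fun _ => unit) <| .seq (.pop .arr keep) <|
      .ite holds (.seq (.push .buf held) (.ite (fun _ => w) (.push .clk fun _ => unit) (.load id)))
        (.load id)

/-- The counter may exceed the array length. `tmp` then still receives all of it, so that it can be
restored, whereas the clock gets one unit per cell actually moved, which is exactly the number of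
rounds of `rep`. -/
theorem exec_scan (w : Bool) (m : ℕ) (h : r x = m) (hn : 9 * m + 2 ≤ n) :
    Exec (scan x w) v (stk i o a b t c r) (none, v.2)
      (stk i o (a.drop m) ((a.take m).reverse ++ b) (t + m)
        ((if w then List.replicate (min m a.length) unit else []) ++ c) (Function.update r x 0))
      n := by
  induction m generalizing a b t c r v n with
  | zero =>
    have : Function.update r x 0 = r := by rw [← h, Function.update_eq_self]
    simpa [this] using! exec_drain_stop (exec_popReg_zero h le_rfl) rfl (by omega)
  | succ m ih =>
    cases a with
    | nil =>
      refine exec_drain_next (exec_popReg_succ h le_rfl) rfl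
        (.seq (exec_pushTmp le_rfl) (.seq (exec_popArr le_rfl)
          (.ite_false rfl (.load le_rfl) le_rfl) le_rfl) le_rfl)
        (S₃ := stk i o _ _ _ _ _) (n₃ := 9 * m + 2) ?_ (by omega)
      have := ih (a := []) (b := b) (t := t + 1) (c := c) (r := Function.update r x m)
        (v := (none, v.2)) (by simp) le_rfl
      simpa [add_assoc, add_comm 1 m] using! this
    | cons s a =>
      have e : Exec (.ite (fun _ => w) (.push .clk fun _ => unit) (.load id)) (some s, v.2)
          (stk i o a (s :: b) (t + 1) c (Function.update r x m)) (some s, v.2)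
          (stk i o a (s :: b) (t + 1) ((if w then [unit] else []) ++ c)
            (Function.update r x m)) 2 := by
        cases w
        · exact .ite_false rfl (.load le_rfl) le_rfl
        · exact .ite_true rfl (exec_pushClk le_rfl) le_rfl
      refine exec_drain_next (exec_popReg_succ h le_rfl) rfl
        (.seq (exec_pushTmp le_rfl) (.seq (exec_popArr le_rfl)
          (.ite_true rfl (.seq (exec_pushBuf le_rfl) e le_rfl) le_rfl) le_rfl) le_rfl)
        (S₃ := stk i o _ _ _ _ _) (n₃ := 9 * m + 2) ?_ (by omega)
      have := ih (a := a) (b := s :: b) (t := t + 1) (c := (if w then [unit] else []) ++ c)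
        (r := Function.update r x m) (v := (some s, v.2)) (by simp) le_rfl
      cases w
      · simpa [add_assoc, add_comm 1 m] using! this
      · simpa [add_assoc, add_comm 1 m, List.replicate_succ', Nat.succ_min_succ] using! this

/-- Undo `scan`. -/
def restore (x : ρ) : StackProg (Alphabet (ρ := ρ)) Control :=
  .seq (drain .tmp keep holds (.push (.reg x) fun _ => unit))
    (drain .buf keep holds (.push .arr held))

theorem exec_restore_tmp (hn : 3 * t + 2 ≤ n) :
    Exec (drain .tmp keep holds (.push (.reg x) fun _ => unit)) v (stk i o a b t c r) (none, v.2)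
      (stk i o a b 0 c (Function.update r x (r x + t))) n := by
  induction t generalizing r v n with
  | zero => simpa using exec_drain_stop (exec_popTmp_zero le_rfl) rfl (by omega)
  | succ t ih =>
    refine exec_drain_next (exec_popTmp_succ le_rfl) rfl (exec_pushReg le_rfl) (n₃ := 3 * t + 2)
      ?_ (by omega)
    have := ih (r := Function.update r x (r x + 1)) (v := (some unit, v.2)) le_rfl
    simpa [add_assoc, add_comm 1 t] using this

theorem exec_restore_buf (hn : 3 * b.length + 2 ≤ n) :
    Exec (drain .buf keep holds (.push .arr held)) v (stk i o a b t c r) (none, v.2)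
      (stk i o (b.reverse ++ a) [] t c r) n := by
  induction b generalizing a v n with
  | nil => exact exec_drain_stop (exec_popBuf le_rfl) rfl (by omega)
  | cons s b ih =>
    simp only [List.length_cons] at hn
    refine exec_drain_next (exec_popBuf le_rfl) rfl (exec_pushArr le_rfl)
      (n₃ := 3 * b.length + 2) ?_ (by omega)
    simpa using! ih (a := s :: a) (v := (some s, v.2)) le_rfl

theorem exec_restore (h : r x = 0) (hn : 3 * t + 3 * b.length + 4 ≤ n) :
    Exec (restore x) v (stk i o a b t c r) (none, v.2)
      (stk i o (b.reverse ++ a) [] 0 c (Function.update r x t)) n := by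
  have := exec_restore_tmp (i := i) (o := o) (a := a) (b := b) (t := t) (c := c) (r := r) (x := x)
    (v := v) le_rfl
  rw [h, zero_add] at this
  exact .seq this (exec_restore_buf le_rfl) (by omega)

/-- Apply `f` to the array cell at position `reg x` and keep the value of `b` at the former
contents of this cell. -/
def access (x : ρ) (f : ArrayCell → ArrayCell) (b : ArrayCell → Bool) :
    StackProg (Alphabet (ρ := ρ)) Control :=
  .seq (scan x false) <| .seq (.pop .arr keep) <| .seq (.load fun v => (v.1, v.1.any b)) <|
    .seq (.ite holds (.push .arr fun v => f (held v)) (.load id)) (restore x)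

theorem exec_access {f : ArrayCell → ArrayCell} {p : ArrayCell → Bool}
    (hn : 12 * r x + 3 * a.length + 10 ≤ n) :
    Exec (access x f p) v (stk i o a [] 0 c r) (none, (a[r x]?).any p)
      (stk i o (a.modify (r x) f) [] 0 c r) n := by
  have h₁ := exec_scan (i := i) (o := o) (a := a) (b := []) (t := 0) (c := c) (v := v) false
    (r x) rfl le_rfl
  have h₂ : ∀ a' w, Exec (restore x) (w, (a[r x]?).any p)
      (stk i o a' ((a.take (r x)).reverse ++ []) (0 + r x)
        ((if false then List.replicate (min (r x) a.length) unit else []) ++ c)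
        (Function.update r x 0)) (none, (a[r x]?).any p)
      (stk i o (a.take (r x) ++ a') [] 0 c r) (3 * r x + 3 * a.length + 4) := by
    intro a' w
    have := exec_restore (x := x) (i := i) (o := o) (a := a') (b := (a.take (r x)).reverse)
      (t := r x) (c := c) (r := Function.update r x 0) (v := (w, (a[r x]?).any p))
      (n := 3 * r x + 3 * a.length + 4) (by simp) (by simp)
    simpa using this
  rcases lt_or_ge (r x) a.length with h | h
  · rw [List.modify_eq_take_cons_drop h]
    rw [List.drop_eq_getElem_cons h] at h₁
    have e : (a[r x]?).any p = (some a[r x]).any p := by rw [List.getElem?_eq_getElem h]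
    have h₃ := h₂ (f a[r x] :: a.drop (r x + 1)) (some a[r x])
    rw [e] at h₃ ⊢
    exact .seq h₁ (.seq (exec_popArr le_rfl) (.seq (.load le_rfl)
      (.seq (.ite_true rfl (exec_pushArr le_rfl) le_rfl) h₃ le_rfl) le_rfl) le_rfl) (by omega)
  -- Beyond the end of the array the pop finds nothing: the flag becomes false and the array is
  -- restored unchanged, as `modify` prescribes.
  · have e : (a[r x]?).any p = (none : Option ArrayCell).any p := by
      rw [List.getElem?_eq_none h]
    have h₃ := h₂ [] none
    rw [e, List.take_of_length_le h] at h₃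
    rw [List.drop_eq_nil_of_le h, List.take_of_length_le h] at h₁
    simp only [List.append_nil] at h₁ h₃
    rw [e, List.modify_eq_self h]
    exact .seq h₁ (.seq (exec_popArr le_rfl) (.seq (.load le_rfl)
      (.seq (.ite_false rfl (.load le_rfl) le_rfl) h₃ le_rfl) le_rfl) le_rfl) (by omega)

/-- The stack program simulating a counter program. -/
def compile : CounterProg ρ → StackProg (Alphabet (ρ := ρ)) Control
  | .nop => .load id
  | .inc x => .push (.reg x) fun _ => unit
  | .dec x => .pop (.reg x) keep
  | .clr x => drain (.reg x) keep holds (.load id)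
  | .ifZero x p q =>
    .seq (.pop (.reg x) keep)
      (.ite holds (.seq (.push (.reg x) fun _ => unit) (compile q)) (compile p))
  | .test x b p q => .seq (access x id b) (.ite Prod.snd (compile p) (compile q))
  | .upd x f => access x f fun _ => false
  | .rep x p =>
    .seq (.push .clk fun _ => sep) <| .seq (scan x true) <| .seq (restore x) <|
      drain .clk keep (fun v => v.1 == some unit) (compile p)
  | .seq p q => .seq (compile p) (compile q)

/-- Each round consumes one unit of the clock, and the separator below keeps the clocks `c` of
enclosing loops out of reach. As the growth `G` per round does not depend on the counters, they stay
below `M'` throughout, and every round costs at most `T M'`. -/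
theorem exec_rep {p : CounterProg ρ} {T : ℕ → ℕ} (hT : Monotone T) {G : ℕ}
    {B : ℕ} (hp : ∀ (m : CounterMem ρ) (M : ℕ), m.arr.length = B → (∀ y, m.reg y ≤ M) →
      (∀ y, (run p m).reg y ≤ M + G) ∧ ∀ v c, ∃ v', Exec (compile p) v
        (stk [] [] m.arr [] 0 c m.reg) v' (stk [] [] (run p m).arr [] 0 c (run p m).reg) (T M))
    (k M' : ℕ) {m : CounterMem ρ} {M : ℕ} (hm : m.arr.length = B) (hM : ∀ y, m.reg y ≤ M)
    (hM' : M + k * G ≤ M') :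
    (∀ y, ((run p)^[k] m).reg y ≤ M + k * G) ∧ ∀ v c, ∃ v',
      Exec (drain .clk keep (fun v => v.1 == some unit) (compile p)) v
        (stk [] [] m.arr [] 0 (List.replicate k unit ++ sep :: c) m.reg) v'
        (stk [] [] ((run p)^[k] m).arr [] 0 c ((run p)^[k] m).reg) (k * (T M' + 2) + 2) := by
  induction k generalizing m M with
  | zero =>
    refine ⟨by simpa using hM, fun v c => ⟨_, exec_drain_stop (exec_popClk le_rfl) ?_ (by omega)⟩⟩
    rfl
  | succ k ih =>
    obtain ⟨h₁, h₂⟩ := hp m M hm hM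
    obtain ⟨h₃, h₄⟩ := ih ((length_arr_run p m).trans hm) h₁
      (by rw [add_assoc, add_comm G, ← Nat.succ_mul]; exact hM')
    refine ⟨fun y => (h₃ y).trans (by rw [add_assoc, add_comm G, ← Nat.succ_mul]),
      fun v c => ?_⟩
    obtain ⟨v₁, e₁⟩ := h₂ (some unit, v.2) (List.replicate k unit ++ sep :: c)
    obtain ⟨v₂, e₂⟩ := h₄ v₁ c
    have hle : T M ≤ T M' := hT (by omega)
    refine ⟨v₂, exec_drain_next (exec_popClk le_rfl) rfl e₁ e₂ ?_⟩
    rw [Nat.succ_mul]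
    omega

/-- The simulation takes polynomially many steps, and the counters grow by a polynomial amount. -/
theorem exists_exec_compile (p : CounterProg ρ) : ∃ G T : Polynomial ℕ,
    ∀ (m : CounterMem ρ) (M : ℕ), (∀ y, m.reg y ≤ M) → (∀ y, (run p m).reg y ≤ M + G.eval m.arr.length) ∧
      ∀ v c, ∃ v', Exec (compile p) v (stk [] [] m.arr [] 0 c m.reg) v'
        (stk [] [] (run p m).arr [] 0 c (run p m).reg) (T.eval (M + m.arr.length)) := by
  induction p with
  | nop =>
    exact ⟨0, 1, fun m M hM => ⟨by simpa [run] using hM, fun v c => ⟨_, .load (by simp)⟩⟩⟩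
  | inc x =>
    refine ⟨1, 1, fun m M hM => ⟨fun y => ?_, fun v c => ⟨_, exec_pushReg (by simp)⟩⟩⟩
    by_cases h : y = x
    · subst h; simpa [run] using hM y
    · simpa [run, h] using (hM y).trans (Nat.le_succ M)
  | dec x =>
    refine ⟨0, 1, fun m M hM => ⟨fun y => ?_, fun v c => ?_⟩⟩
    · have := hM y
      by_cases h : y = x
      · subst h; simp [run]; omega
      · simpa [run, h] using this
    · rcases h : m.reg x with _ | k
      · refine ⟨(none, v.2), ?_⟩
        have := exec_popReg_zero (i := []) (o := []) (a := m.arr) (b := []) (t := 0) (c := c)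
          (v := v) h le_rfl
        have e : Function.update m.reg x 0 = m.reg := by rw [← h, Function.update_eq_self]
        simpa [run, h, compile, e] using this
      · exact ⟨_, by simpa [run, h] using! exec_popReg_succ h le_rfl⟩
  | clr x =>
    refine ⟨0, 3 * Polynomial.X + 2, fun m M hM => ⟨fun y => ?_, fun v c => ⟨_, exec_clr rfl ?_⟩⟩⟩
    · by_cases h : y = x
      · subst h; simp [run]
      · simpa [run, h] using hM y
    · have := hM x
      simp only [Polynomial.eval_add, Polynomial.eval_ofNat, Polynomial.eval_mul, Polynomial.eval_X]
      omega
  | ifZero x p q ihp ihq =>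
    obtain ⟨G₁, T₁, h₁⟩ := ihp
    obtain ⟨G₂, T₂, h₂⟩ := ihq
    refine ⟨G₁ + G₂, T₁ + T₂ + 3, fun m M hM => ?_⟩
    simp only [Polynomial.eval_add, Polynomial.eval_ofNat]
    obtain ⟨h₁, h₁'⟩ := h₁ m M hM
    obtain ⟨h₂, h₂'⟩ := h₂ m M hM
    rcases h : m.reg x with _ | k
    · simp only [run, h, if_true]
      refine ⟨fun y => (h₁ y).trans (by omega), fun v c => ?_⟩
      obtain ⟨v', e⟩ := h₁' (none, v.2) c
      exact ⟨v', .seq (exec_popReg_zero h le_rfl) (.ite_false rfl e le_rfl) (by omega)⟩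
    · simp only [run, h, Nat.succ_ne_zero, if_false]
      refine ⟨fun y => (h₂ y).trans (by omega), fun v c => ?_⟩
      obtain ⟨v', e⟩ := h₂' (some unit, v.2) c
      have := exec_pushReg (x := x) (v := (some unit, v.2)) (i := []) (o := []) (a := m.arr)
        (b := []) (t := 0) (c := c) (r := Function.update m.reg x k) le_rfl
      have hu : Function.update m.reg x (k + 1) = m.reg := by rw [← h, Function.update_eq_self]
      simp only [Function.update_self, Function.update_idem, hu] at this
      exact ⟨v', .seq (exec_popReg_succ h le_rfl) (.ite_true rfl (.seq this e le_rfl) le_rfl)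
        (by omega)⟩
  | test x b p q ihp ihq =>
    obtain ⟨G₁, T₁, h₁⟩ := ihp
    obtain ⟨G₂, T₂, h₂⟩ := ihq
    refine ⟨G₁ + G₂, T₁ + T₂ + 12 * Polynomial.X + 11, fun m M hM => ?_⟩
    simp only [Polynomial.eval_add, Polynomial.eval_ofNat, Polynomial.eval_mul, Polynomial.eval_X]
    obtain ⟨h₁, h₁'⟩ := h₁ m M hM
    obtain ⟨h₂, h₂'⟩ := h₂ m M hM
    have hx := hM x
    have ha : ∀ v c, Exec (access x id b) v (stk [] [] m.arr [] 0 c m.reg)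
        (none, (m.arr[m.reg x]?).any b) (stk [] [] m.arr [] 0 c m.reg)
        (12 * (M + m.arr.length) + 10) := fun v c => by
      simpa using exec_access (i := []) (o := []) (a := m.arr) (c := c) (v := v) (x := x)
        (r := m.reg) (f := id) (p := b) (n := 12 * (M + m.arr.length) + 10) (by omega)
    rcases h : (m.arr[m.reg x]?).any b with _ | _
    · simp only [run, h, Bool.false_eq_true, if_false]
      refine ⟨fun y => (h₂ y).trans (by omega), fun v c => ?_⟩
      obtain ⟨v', e⟩ := h₂' (none, (m.arr[m.reg x]?).any b) c
      exact ⟨v', .seq (ha v c) (.ite_false h e le_rfl) (by omega)⟩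
    · simp only [run, h, if_true]
      refine ⟨fun y => (h₁ y).trans (by omega), fun v c => ?_⟩
      obtain ⟨v', e⟩ := h₁' (none, (m.arr[m.reg x]?).any b) c
      exact ⟨v', .seq (ha v c) (.ite_true h e le_rfl) (by omega)⟩
  | upd x f =>
    refine ⟨0, 12 * Polynomial.X + 10, fun m M hM => ⟨by simpa [run] using hM, fun v c =>
      ⟨_, exec_access ?_⟩⟩⟩
    have := hM x
    simp only [Polynomial.eval_add, Polynomial.eval_ofNat, Polynomial.eval_mul, Polynomial.eval_X]
    omega
  | seq p q ihp ihq =>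
    obtain ⟨G₁, T₁, h₁⟩ := ihp
    obtain ⟨G₂, T₂, h₂⟩ := ihq
    refine ⟨G₁ + G₂, T₁ + T₂.comp (Polynomial.X + G₁), fun m M hM => ?_⟩
    simp only [Polynomial.eval_add, Polynomial.eval_comp, Polynomial.eval_X]
    obtain ⟨h₁, h₁'⟩ := h₁ m M hM
    obtain ⟨h₂, h₂'⟩ := h₂ (run p m) _ h₁
    rw [length_arr_run] at h₂ h₂'
    refine ⟨fun y => (h₂ y).trans (by omega), fun v c => ?_⟩
    obtain ⟨v₁, e₁⟩ := h₁' v c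
    obtain ⟨v₂, e₂⟩ := h₂' v₁ c
    refine ⟨v₂, .seq e₁ e₂ (Nat.add_le_add_left (T₂.monotone_eval_nat ?_) _)⟩
    have := G₁.monotone_eval_nat (Nat.le_add_left m.arr.length M)
    simp only at this
    omega
  | rep x p ih =>
    obtain ⟨G, T, h⟩ := ih
    -- The argument of `T` dominates the counters during all rounds together with the array length.
    -- The linear term pays for the separator, the scan, its undoing and the final pop.
    refine ⟨Polynomial.X * G, Polynomial.X * (T.comp (2 * Polynomial.X + Polynomial.X * G) + 2) +
      15 * Polynomial.X + 9, fun m M hM => ?_⟩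
    simp only [Polynomial.eval_add, Polynomial.eval_ofNat, Polynomial.eval_mul, Polynomial.eval_X,
      Polynomial.eval_comp]
    set B := m.arr.length
    set k := min (m.reg x) B with hk
    have hkB : k ≤ B := min_le_right _ _
    have hx := hM x
    have hG := G.monotone_eval_nat (Nat.le_add_left B M)
    have hkG : k * G.eval B ≤ B * G.eval B := Nat.mul_le_mul_right _ hkB
    have hBG : B * G.eval B ≤ (M + B) * G.eval (M + B) := Nat.mul_le_mul (Nat.le_add_left _ _) hG
    obtain ⟨h₁, h₂⟩ := exec_rep (p := p) (T := fun M => T.eval (M + B)) (G := G.eval B) (B := B)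
      (fun a b hab => T.monotone_eval_nat (by omega))
      (fun m M hm hM => by have := h m M hM; rwa [hm] at this) k (M + B * G.eval B) (m := m) rfl hM
      (by omega)
    refine ⟨fun y => (h₁ y).trans (by omega), fun v c => ?_⟩
    have e₁ := exec_scan (i := []) (o := []) (a := m.arr) (b := []) (t := 0) (c := sep :: c)
      (v := v) true (m.reg x) rfl le_rfl
    have e₂ := exec_restore (x := x) (i := []) (o := []) (a := m.arr.drop (m.reg x))
      (b := (m.arr.take (m.reg x)).reverse) (t := m.reg x)
      (c := List.replicate k unit ++ sep :: c) (r := Function.update m.reg x 0) (v := (none, v.2))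
      (n := 3 * m.reg x + 3 * B + 4) (by simp) (by simp [B])
    simp only [List.reverse_reverse, List.take_append_drop, Function.update_idem,
      Function.update_eq_self] at e₂
    obtain ⟨v', e₃⟩ := h₂ (none, v.2) c
    simp only [List.append_nil, if_true, zero_add] at e₁
    refine ⟨v', .seq (exec_pushClk le_rfl) (.seq e₁ (.seq e₂ e₃ le_rfl) le_rfl) ?_⟩
    have hT : T.eval (M + B * G.eval B + B) ≤
        T.eval (2 * (M + B) + (M + B) * G.eval (M + B)) := T.monotone_eval_nat (by omega)
    have : k * (T.eval (M + B * G.eval B + B) + 2) ≤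
        (M + B) * (T.eval (2 * (M + B) + (M + B) * G.eval (M + B)) + 2) :=
      Nat.mul_le_mul (by omega) (by omega)
    omega

end exec

end CounterProg

/-! ### Input, output and the resulting machine -/

namespace CounterProg

open StackProg (Exec)

variable {ρ : Type} [DecidableEq ρ]

/-- Read the input into the array and count the separators in the counter `x`. -/
def readInput (x : ρ) : StackProg (Alphabet (ρ := ρ)) Control :=
  .seq
    (drain .inp (fun v (s : Option (Option Bool)) => (s.map fun e => (e, false), v.2)) holds
      (.seq (.push .buf held)
        (.ite (fun v => (held v).1 == none) (.push (.reg x) fun _ => unit) (.load id))))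
    (drain .buf keep holds (.push .arr held))

theorem exec_readInput_drain {x : ρ} {w : List (Option Bool)} {b : List ArrayCell} {r : ρ → ℕ}
    {v : Control} {n : ℕ} (hn : 5 * w.length + 2 ≤ n) :
    Exec (drain .inp (fun v (s : Option (Option Bool)) => (s.map fun e => (e, false), v.2)) holds
      (.seq (.push .buf held)
        (.ite (fun v => (held v).1 == none) (.push (.reg x) fun _ => unit) (.load id))))
      v (stk w [] [] b 0 [] r) (none, v.2) (stk [] [] [] ((w.map fun e => (e, false)).reverse ++ b)
        0 [] (Function.update r x (r x + w.count none))) n := by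
  induction w generalizing b r v n with
  | nil =>
    refine exec_drain_stop (.pop_eq le_rfl rfl ?_) rfl (by omega)
    simp [update_inp, stk]
  | cons e w ih =>
    simp only [List.length_cons] at hn
    have e₁ : Exec (.ite (fun v => (held v).1 == none) (.push (.reg x) fun _ => unit) (.load id))
        (some (e, false), v.2) (stk w [] [] ((e, false) :: b) 0 [] r) (some (e, false), v.2)
        (stk w [] [] ((e, false) :: b) 0 []
          (Function.update r x (r x + [e].count none))) 2 := by
      cases e with
      | none => exact .ite_true rfl (exec_pushReg le_rfl) le_rfl
      | some e => exact .ite_false rfl (by simpa using! Exec.load (f := id) le_rfl) le_rfl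
    refine exec_drain_next (.pop_eq le_rfl rfl (update_inp ..)) rfl
      (.seq (exec_pushBuf le_rfl) e₁ le_rfl) (n₃ := 5 * w.length + 2) ?_ (by omega)
    have := ih (b := (e, false) :: b) (r := Function.update r x (r x + [e].count none))
      (v := (some (e, false), v.2)) le_rfl
    have hc : (e :: w).count none = [e].count none + w.count none := by
      rw [← List.count_append, List.singleton_append]
    simpa [hc, add_assoc] using! this

theorem exec_readInput {x : ρ} {w : List (Option Bool)} {v : Control} {n : ℕ}
    (hn : 8 * w.length + 4 ≤ n) :
    Exec (readInput x) v (stk w [] [] [] 0 [] fun _ => 0) (none, v.2)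
      (stk [] [] (w.map fun e => (e, false)) [] 0 []
        (Function.update (fun _ => 0) x (w.count none))) n := by
  have h₁ := exec_readInput_drain (x := x) (w := w) (b := []) (r := fun _ => 0) (v := v) le_rfl
  have h₂ := exec_restore_buf (i := []) (o := []) (a := [])
    (b := (w.map fun e => ((e, false) : ArrayCell)).reverse) (t := 0) (c := [])
    (r := Function.update (fun _ => 0) x (w.count none)) (v := (none, v.2)) le_rfl
  simp only [List.append_nil, zero_add, List.reverse_reverse, List.length_reverse,
    List.length_map] at h₁ h₂
  exact .seq h₁ h₂ (by omega)

/-- Empty the listed stacks. -/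
def clear : List (StackName ρ) → StackProg (Alphabet (ρ := ρ)) Control
  | [] => .load id
  | k :: l => .seq (drain k (fun v s => (s.map fun _ => unit, v.2)) holds (.load id)) (clear l)

theorem exec_clear_one {k : StackName ρ} {L : List (Alphabet k)} {v : Control}
    {S : ∀ k, List (Alphabet k)} {n : ℕ} (hS : S k = L) (hn : 3 * L.length + 2 ≤ n) :
    Exec (drain k (fun v s => (s.map fun _ => unit, v.2)) holds (.load id)) v S (none, v.2)
      (Function.update S k []) n := by
  induction L generalizing v S n with
  | nil => exact exec_drain_stop (.pop_eq le_rfl (by simp [hS]) (by simp [hS])) rfl (by omega)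
  | cons s L ih =>
    simp only [List.length_cons] at hn
    refine exec_drain_next (v₁ := (some unit, v.2)) (S₁ := Function.update S k L)
      (.pop_eq le_rfl (by simp [hS]) (by simp [hS])) rfl (.load le_rfl) (n₃ := 3 * L.length + 2) ?_
      (by omega)
    simpa using ih (S := Function.update S k L) (v := (some unit, v.2)) (by simp) le_rfl

theorem exec_clear {l : List (StackName ρ)} {v : Control} {S : ∀ k, List (Alphabet k)} {N : ℕ}
    (hS : ∀ k, (S k).length ≤ N) :
    ∃ s, Exec (clear l) v S (s, v.2) (fun k => if k ∈ l then [] else S k)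
      (l.length * (3 * N + 2) + 1) := by
  induction l generalizing v S with
  | nil => exact ⟨v.1, by simpa using! Exec.load (f := id) (by omega)⟩
  | cons k l ih =>
    obtain ⟨s, h⟩ := ih (v := (none, v.2)) (S := Function.update S k []) (fun k' => by
      by_cases e : k' = k
      · subst e; simp
      · simpa [e] using hS k')
    refine ⟨s, .seq (exec_clear_one rfl (Nat.add_le_add_right (Nat.mul_le_mul_left 3 (hS k)) 2)) ?_
      (n₂ := l.length * (3 * N + 2) + 1) (by simp only [List.length_cons]; ring_nf; omega)⟩
    convert! h using 2 with k'
    by_cases e : k' = k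
    · subst e; simp
    · simp [e]

/-- Output whether the counter `x` is positive, and restore the initial state. -/
noncomputable def writeOutput [Fintype ρ] (x : ρ) : StackProg (Alphabet (ρ := ρ)) Control :=
  .seq (.pop (.reg x) keep) <| .seq (.load fun v => (none, v.1.isSome)) <|
    .seq (clear Finset.univ.toList) <| .seq (.push .out Prod.snd) (.load fun _ => (none, false))

/-- The halting configuration has only the output stack filled and is in the initial control state.
So the answer is carried in the Boolean of the control state while all stacks are emptied. -/
theorem exec_writeOutput [Fintype ρ] {x : ρ} {a : List ArrayCell} {r : ρ → ℕ} {v : Control} {N : ℕ}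
    (ha : a.length ≤ N) (hr : ∀ y, r y ≤ N) :
    Exec (writeOutput x) v (stk [] [] a [] 0 [] r) (none, false)
      (Function.update (fun _ => []) .out [decide (r x ≠ 0)])
      (Fintype.card (StackName ρ) * (3 * N + 2) + 5) := by
  obtain ⟨r', hr', h⟩ : ∃ r' : ρ → ℕ, (∀ y, r' y ≤ N) ∧ ∃ s : Option ArrayCell,
      s.isSome = decide (r x ≠ 0) ∧
        Exec (.pop (Γ := Alphabet (ρ := ρ)) (.reg x) keep) v (stk [] [] a [] 0 [] r) (s, v.2)
          (stk [] [] a [] 0 [] r') 1 := by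
    rcases e : r x with _ | k
    · exact ⟨r, hr, none, rfl, exec_popReg_zero e le_rfl⟩
    · refine ⟨Function.update r x k, fun y => ?_, some unit, by simp, exec_popReg_succ e le_rfl⟩
      by_cases h : y = x
      · subst h; have := hr y; simp; omega
      · simpa [h] using hr y
  obtain ⟨s, hs, h₁⟩ := h
  obtain ⟨s', h₂⟩ := exec_clear (l := Finset.univ.toList) (v := (none, s.isSome))
    (S := stk [] [] a [] 0 [] r') (N := N) (by rintro (_ | _) <;> simp [stk, ha, hr'])
  simp only [Finset.mem_toList, Finset.mem_univ, if_true, Finset.length_toList,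
    Finset.card_univ] at h₂
  refine .seq h₁ (.seq (.load le_rfl) (.seq h₂ (.seq (.push_eq le_rfl ?_) (.load le_rfl) le_rfl)
    le_rfl) le_rfl) (by omega)
  rw [hs]

/-- What a counter program decides is decidable in polynomial time. -/
theorem nonempty_computableInPolyTime [Fintype ρ] (p : CounterProg ρ) (x y : ρ) {α : Type}
    {ea : α → List (Option Bool)} {f : α → Bool}
    (hf : ∀ a, f a = decide ((run p ⟨Function.update (fun _ => 0) x ((ea a).count none),
      (ea a).map fun e => (e, false)⟩).reg y ≠ 0)) :
    Nonempty (Turing.TM2ComputableInPolyTime ea Computability.encodeBool f) := by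
  obtain ⟨G, T, h⟩ := exists_exec_compile p
  refine StackProg.nonempty_computableInPolyTime (k₀ := StackName.inp) (k₁ := StackName.out)
    (Γ := Alphabet (ρ := ρ)) (none, false)
    (.seq (readInput x) (.seq (compile p) (writeOutput y)))
    -- Reading, computing, writing. Initially the counters and the array length are both at most the
    -- input length, whence `2 * X`; afterwards the counters are at most `X + G`.
    (8 * Polynomial.X + 4 + (T.comp (2 * Polynomial.X) +
      ((Fintype.card (StackName ρ) : Polynomial ℕ) * (3 * (Polynomial.X + G) + 2) + 5)))
    (Equiv.refl _) (Equiv.refl _) fun a => ?_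
  have hw : ∀ z, Function.update (fun _ : ρ => 0) x ((ea a).count none) z ≤ (ea a).length := by
    intro z
    by_cases e : z = x
    · subst e; simpa using List.count_le_length
    · simp [e]
  obtain ⟨h₁, h₂⟩ := h ⟨Function.update (fun _ => 0) x ((ea a).count none),
      (ea a).map fun e => (e, false)⟩ _ hw
  simp only [List.length_map] at h₁ h₂
  obtain ⟨v, e₂⟩ := h₂ (none, false) []
  have ha : (run p ⟨Function.update (fun _ => 0) x ((ea a).count none),
      (ea a).map fun e => (e, false)⟩).arr.length ≤ (ea a).length + G.eval (ea a).length := by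
    rw [length_arr_run, List.length_map]
    omega
  have e₃ := exec_writeOutput (ρ := ρ) (x := y) (v := v) (N := (ea a).length + G.eval (ea a).length)
    ha h₁
  have e₁ := exec_readInput (ρ := ρ) (x := x) (w := ea a) (v := (none, false)) le_rfl
  rw [← hf] at e₃
  have hi : Function.update (β := fun k : StackName ρ => List (Alphabet k)) (fun _ => [])
      StackName.inp (ea a) = stk (ρ := ρ) (ea a) [] [] [] 0 [] fun _ => 0 := by
    funext k; cases k <;> simp [Function.update, stk]
  rw [← hi] at e₁
  simp only [Equiv.refl_symm, Equiv.coe_refl, List.map_id]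
  refine .seq e₁ (.seq e₂ e₃ le_rfl) (le_of_eq ?_)
  simp [two_mul]

end CounterProg

/-! ### Greedy domination -/

namespace SimpleGraph

section greedy

variable {V : Type*} [Fintype V] [DecidableEq V] (G : SimpleGraph V)

open Classical in
/-- The closed neighborhood of a vertex. -/
noncomputable def closedNbhd (v : V) : Finset V := {u | u = v ∨ G.Adj v u}

theorem mem_closedNbhd {u v : V} : u ∈ G.closedNbhd v ↔ u = v ∨ G.Adj v u := by
  simp [closedNbhd]

/-- The number of vertices outside `D` that are dominated by `v`. -/
noncomputable def gain (D : Finset V) (v : V) : ℕ := (G.closedNbhd v \ D).card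

/-- Select the vertex `v` if it dominates at least a `1 / s` fraction of the vertices outside the
set `D` of dominated vertices. -/
noncomputable def greedyStep (s : ℕ) (D : Finset V) (v : V) : Finset V :=
  if Fintype.card V - D.card ≤ s * G.gain D v then D ∪ G.closedNbhd v else D

variable {G}

theorem card_union_closedNbhd (D : Finset V) (v : V) :
    (D ∪ G.closedNbhd v).card = D.card + G.gain D v := by
  rw [gain, Finset.union_comm, ← Finset.card_sdiff_add_card, add_comm]

theorem subset_greedyStep (s : ℕ) (D : Finset V) (v : V) : D ⊆ G.greedyStep s D v := by
  unfold greedyStep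
  split_ifs
  · exact Finset.subset_union_left
  · exact subset_rfl

theorem subset_foldl_greedyStep (s : ℕ) (D : Finset V) (l : List V) :
    D ⊆ l.foldl (G.greedyStep s) D := by
  induction l generalizing D with
  | nil => exact subset_rfl
  | cons v l ih => exact (subset_greedyStep s D v).trans (ih _)

/-- The sets only grow along a pass, so a pass without net effect changes nothing at any vertex. -/
theorem eq_of_foldl_greedyStep_eq {s : ℕ} {D : Finset V} {l : List V}
    (h : l.foldl (G.greedyStep s) D = D) : ∀ v ∈ l, G.greedyStep s D v = D := by
  induction l with
  | nil => simp
  | cons a l ih =>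
    have ha : G.greedyStep s D a = D :=
      ((subset_foldl_greedyStep s _ l).trans h.le).antisymm (subset_greedyStep s D a)
    rw [List.foldl_cons, ha] at h
    intro v hv
    rcases List.mem_cons.1 hv with rfl | hv
    · exact ha
    · exact ih h v hv

/-- A selected vertex leaving `D` unchanged would have gain 0, and then the test passes only if
nothing is undominated. -/
theorem lt_of_greedyStep_eq {s : ℕ} {D : Finset V} (hD : D.card < Fintype.card V) {v : V}
    (h : G.greedyStep s D v = D) : s * G.gain D v < Fintype.card V - D.card := by
  by_contra! hle
  rw [greedyStep, if_pos hle] at h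
  have := congrArg Finset.card h
  rw [card_union_closedNbhd] at this
  have h0 : G.gain D v = 0 := by omega
  rw [h0, mul_zero] at hle
  omega

/-- Iterated passes over all vertices either dominate everything or get stuck. -/
theorem iterate_greedy_eq_univ_or (s : ℕ) {l : List V} (hl : ∀ v, v ∈ l) :
    ((fun D => l.foldl (G.greedyStep s) D)^[Fintype.card V] ∅).card = Fintype.card V ∨
      ∃ D : Finset V, (fun D => l.foldl (G.greedyStep s) D)^[Fintype.card V] ∅ = D ∧
        D.card < Fintype.card V ∧ ∀ v, s * G.gain D v < Fintype.card V - D.card := by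
  set F : Finset V → Finset V := fun D => l.foldl (G.greedyStep s) D with hF
  -- Each pass before a fixed point adds at least one vertex; with `k` the order of the graph, an
  -- incomplete set must be a fixed point.
  have key : ∀ k, k ≤ (F^[k] ∅).card ∨ F (F^[k] ∅) = F^[k] ∅ := by
    intro k
    induction k with
    | zero => simp
    | succ k ih =>
      rw [Function.iterate_succ_apply']
      by_cases h : F (F^[k] ∅) = F^[k] ∅
      · right; rw [h, h]
      · left
        have hlt := Finset.card_lt_card
          ((subset_foldl_greedyStep s (F^[k] ∅) l).ssubset_of_ne (Ne.symm h))
        have := ih.resolve_right h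
        simp only [hF] at hlt ⊢ this
        omega
  have hle := Finset.card_le_univ (F^[Fintype.card V] ∅)
  rcases hle.eq_or_lt with h | h
  · exact .inl h
  · exact .inr ⟨_, rfl, h, fun v => lt_of_greedyStep_eq h <|
      eq_of_foldl_greedyStep_eq ((key _).resolve_left (by omega)) v (hl v)⟩

/-- Averaging: with u undominated vertices, a minimum dominating set `T` satisfies s·u ≤ s·∑ gain <
|T|·u. -/
theorem lt_dominationNumber {s : ℕ} {D : Finset V} (hD : D.card < Fintype.card V)
    (h : ∀ v, s * G.gain D v < Fintype.card V - D.card) : s < G.dominationNumber := by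
  obtain ⟨T, hT, hc⟩ : ∃ T : Finset V, G.IsDominating T ∧ T.card = G.dominationNumber :=
    Nat.sInf_mem (s := {k : ℕ | ∃ D : Finset V, G.IsDominating D ∧ D.card = k})
      ⟨_, Finset.univ, fun v hv => absurd (Finset.mem_univ v) hv, rfl⟩
  rw [← hc]
  have hcov : Finset.univ \ D ⊆ T.biUnion fun v => G.closedNbhd v \ D := by
    intro u hu
    have huD := (Finset.mem_sdiff.1 hu).2
    simp only [Finset.mem_biUnion, Finset.mem_sdiff, mem_closedNbhd]
    by_cases huT : u ∈ T
    · exact ⟨u, huT, .inl rfl, huD⟩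
    · obtain ⟨w, hw, ha⟩ := hT u huT
      exact ⟨w, hw, .inr ha.symm, huD⟩
  have hle : Fintype.card V - D.card ≤ ∑ v ∈ T, G.gain D v := by
    have := (Finset.card_le_card hcov).trans Finset.card_biUnion_le
    rwa [Finset.card_sdiff_of_subset (Finset.subset_univ D), Finset.card_univ] at this
  -- The strict inequality between the sums needs a summand.
  have hne : T.Nonempty := by
    by_contra hne
    rw [Finset.not_nonempty_iff_eq_empty] at hne
    rw [hne, Finset.sum_empty] at hle
    omega
  have hlt : ∑ v ∈ T, s * G.gain D v < ∑ v ∈ T, (Fintype.card V - D.card) :=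
    Finset.sum_lt_sum_of_nonempty hne fun v _ => h v
  rw [← Finset.mul_sum, Finset.sum_const, smul_eq_mul] at hlt
  by_contra! hs
  have h1 := Nat.mul_le_mul_left s hle
  have h2 := Nat.mul_le_mul_right (Fintype.card V - D.card) hs
  omega

/-- `k` selected vertices dominate exactly the vertices in `D`, and the number of the other vertices
decreases exponentially with rate `1 - 1 / s` at first, and then by one in each step. -/
def GreedyBound (G : SimpleGraph V) (s K : ℕ) (D : Finset V) : Prop :=
  ∃ S : Finset V, (∀ u, u ∈ D ↔ ∃ v ∈ S, u ∈ G.closedNbhd v) ∧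
    ((S.card ≤ K ∧
        ((Fintype.card V - D.card : ℕ) : ℝ) ≤ Fintype.card V * (1 - 1 / (s : ℝ)) ^ S.card) ∨
      (K ≤ S.card ∧ Fintype.card V - D.card + (S.card - K) ≤ s))

theorem greedyBound_empty (s K : ℕ) : GreedyBound G s K ∅ :=
  ⟨∅, by simp, .inl (by simp)⟩

/-- Up to `K` selections, a gain of at least u/s yields the factor 1 - 1/s. At `K` selections, `hK`
turns the exponential bound into u ≤ s, and from then on a gain of at least 1 balances the new
selection. -/
theorem GreedyBound.step {s K : ℕ} (hs : 1 ≤ s)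
    (hK : Fintype.card V * (1 - 1 / (s : ℝ)) ^ K ≤ s) {D : Finset V} (h : GreedyBound G s K D)
    (v : V) : GreedyBound G s K (G.greedyStep s D v) := by
  unfold greedyStep
  split_ifs with hg
  swap
  · exact h
  -- Once everything is dominated the test passes even with gain 0; such a vertex must not be
  -- counted in `S`.
  by_cases h0 : G.gain D v = 0
  · have : D ∪ G.closedNbhd v = D := by
      rw [Finset.union_eq_left, ← Finset.sdiff_eq_empty_iff_subset, ← Finset.card_eq_zero]
      exact h0
    rwa [this]
  obtain ⟨S, hS, hb⟩ := h
  have hv : v ∉ S := by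
    intro hv
    refine h0 ?_
    rw [gain, Finset.card_eq_zero, Finset.sdiff_eq_empty_iff_subset]
    exact fun u hu => (hS u).2 ⟨v, hv, hu⟩
  have hcard := card_union_closedNbhd (G := G) D v
  have hle := Finset.card_le_univ (D ∪ G.closedNbhd v)
  refine ⟨insert v S, fun u => ?_, ?_⟩
  · rw [Finset.mem_union, hS, Finset.exists_mem_insert, or_comm]
  rw [Finset.card_insert_of_notMem hv, hcard]
  have hpos : (0 : ℝ) < s := by exact_mod_cast hs
  have hfac : (0 : ℝ) ≤ 1 - 1 / s := by
    rw [sub_nonneg, div_le_one hpos]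
    exact_mod_cast hs
  have hsecond : K ≤ S.card → Fintype.card V - D.card + (S.card - K) ≤ s →
      K ≤ S.card + 1 ∧ Fintype.card V - (D.card + G.gain D v) + (S.card + 1 - K) ≤ s := by omega
  rcases hb with ⟨hk, hu⟩ | ⟨hk, hu⟩
  · rcases hk.eq_or_lt with hk | hk
    · refine .inr (hsecond hk.ge ?_)
      rw [hk] at hu ⊢
      rw [Nat.sub_self, add_zero]
      exact_mod_cast hu.trans hK
    · refine .inl ⟨hk, ?_⟩
      have e : ((Fintype.card V - (D.card + G.gain D v) : ℕ) : ℝ) =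
          ((Fintype.card V - D.card : ℕ) : ℝ) - G.gain D v := by
        rw [← Nat.cast_sub (by omega), Nat.sub_sub]
      have hg' : ((Fintype.card V - D.card : ℕ) : ℝ) ≤ s * G.gain D v := by exact_mod_cast hg
      have : ((Fintype.card V - D.card : ℕ) : ℝ) / s ≤ G.gain D v := by
        rwa [div_le_iff₀' hpos]
      rw [e, pow_succ, ← mul_assoc]
      calc _ ≤ ((Fintype.card V - D.card : ℕ) : ℝ) * (1 - 1 / s) := by
            rw [mul_sub, mul_one, mul_one_div]; linarith
        _ ≤ _ := mul_le_mul_of_nonneg_right hu hfac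
  · exact .inr (hsecond hk hu)

theorem GreedyBound.foldl {s K : ℕ} (hs : 1 ≤ s)
    (hK : Fintype.card V * (1 - 1 / (s : ℝ)) ^ K ≤ s) {D : Finset V} (h : GreedyBound G s K D)
    (l : List V) : GreedyBound G s K (l.foldl (G.greedyStep s) D) := by
  induction l generalizing D with
  | nil => exact h
  | cons v l ih => exact ih (h.step hs hK v)

theorem GreedyBound.dominationNumber_le {s K : ℕ} {D : Finset V} (h : GreedyBound G s K D)
    (hD : D.card = Fintype.card V) : G.dominationNumber ≤ K + s := by
  obtain ⟨S, hS, hb⟩ := h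
  have hu : D = Finset.univ := Finset.card_eq_iff_eq_univ _ |>.1 hD
  have hdom : G.IsDominating S := by
    intro v hv
    obtain ⟨w, hw, hm⟩ := (hS v).1 (hu ▸ Finset.mem_univ v)
    rcases G.mem_closedNbhd.1 hm with rfl | ha
    · exact absurd hw hv
    · exact ⟨w, hw, ha.symm⟩
  have : G.dominationNumber ≤ S.card := Nat.sInf_le ⟨S, hdom, rfl⟩
  omega

/-- By 1 - 1/s ≤ exp(-1/s), the power is at most exp(-⌈ln(n/s)⌉) ≤ s/n. -/
theorem mul_one_sub_pow_le {n s : ℕ} (hs : 1 ≤ s) (hn : 1 ≤ n) :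
    (n : ℝ) * (1 - 1 / (s : ℝ)) ^ (s * ⌈Real.log ((n : ℝ) / s)⌉₊) ≤ s := by
  have hpos : (0 : ℝ) < s := by exact_mod_cast hs
  have hn : (0 : ℝ) < n := by exact_mod_cast hn
  have hfac : (0 : ℝ) ≤ 1 - 1 / s := by
    rw [sub_nonneg, div_le_one hpos]
    exact_mod_cast hs
  set K := ⌈Real.log ((n : ℝ) / s)⌉₊
  have h1 : (1 - 1 / (s : ℝ)) ^ (s * K) ≤ Real.exp (-(K : ℝ)) := by
    calc _ ≤ Real.exp (-(1 / (s : ℝ))) ^ (s * K) :=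
          pow_le_pow_left₀ hfac (Real.one_sub_le_exp_neg _) _
      _ = _ := by
          rw [← Real.exp_nat_mul]
          congr 1
          push_cast
          field_simp
  have h2 : Real.exp (-(K : ℝ)) ≤ s / n := by
    rw [← Real.log_le_log_iff (Real.exp_pos _) (by positivity), Real.log_exp,
      ← inv_div, Real.log_inv]
    exact neg_le_neg (Nat.le_ceil _)
  calc _ ≤ (n : ℝ) * (s / n) := mul_le_mul_of_nonneg_left (h1.trans h2) hn.le
    _ = s := by field_simp

/-- If passing over all vertices often enough dominates everything, the domination number is
small. -/
theorem dominationNumber_le_of_greedy {s : ℕ} (hs : 1 ≤ s) (hsV : s ≤ Fintype.card V) {l : List V}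
    {k : ℕ} (h : ((fun D => l.foldl (G.greedyStep s) D)^[k] ∅).card = Fintype.card V) :
    (G.dominationNumber : ℝ) ≤
      ((⌈Real.log ((Fintype.card V : ℝ) / (s : ℝ))⌉ : ℝ) + 1) * (s : ℝ) := by
  have hK := mul_one_sub_pow_le hs (hs.trans hsV)
  set K := ⌈Real.log ((Fintype.card V : ℝ) / s)⌉₊ with hKdef
  have hb : ∀ k, GreedyBound G s (s * K) ((fun D => l.foldl (G.greedyStep s) D)^[k] ∅) := by
    intro k
    induction k with
    | zero => exact greedyBound_empty s _
    | succ k ih =>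
      rw [Function.iterate_succ_apply']
      exact ih.foldl hs hK l
  have hle : (G.dominationNumber : ℝ) ≤ ((s * K + s : ℕ) : ℝ) :=
    Nat.cast_le.2 ((hb k).dominationNumber_le h)
  -- The natural-number ceiling agrees with the integer ceiling because s ≤ n makes the logarithm
  -- nonnegative.
  have hlog : 0 ≤ Real.log ((Fintype.card V : ℝ) / s) :=
    Real.log_nonneg ((one_le_div (by exact_mod_cast hs)).2 (by exact_mod_cast hsV))
  rw [← natCast_ceil_eq_intCast_ceil hlog, ← hKdef]
  refine hle.trans_eq ?_
  push_cast
  ring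

end greedy

/-! ### The Slater number -/

/-- Add `d` to the first component and count this in the second component, unless the first
component is at least `n`. -/
def slaterStep (n : ℕ) (x : ℕ × ℕ) (d : ℕ) : ℕ × ℕ := if x.1 < n then (x.1 + d, x.2 + 1) else x

theorem foldl_slaterStep_of_le {n : ℕ} {x : ℕ × ℕ} (h : n ≤ x.1) (l : List ℕ) :
    l.foldl (slaterStep n) x = x := by
  induction l with
  | nil => rfl
  | cons d l ih => rw [List.foldl_cons, slaterStep, if_neg (by omega), ih]

/-- The second component stops increasing as soon as the running sum reaches `n`, so `j` is the
length of the shortest prefix that suffices. -/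
theorem foldl_slaterStep {n : ℕ} (l : List ℕ) (x : ℕ × ℕ) (h : n ≤ x.1 + l.sum) :
    ∃ j, (l.foldl (slaterStep n) x).2 = x.2 + j ∧ n ≤ x.1 + (l.take j).sum ∧
      ∀ i < j, x.1 + (l.take i).sum < n := by
  induction l generalizing x with
  | nil => exact ⟨0, by simp, by simpa using h, by simp⟩
  | cons d l ih =>
    by_cases hx : x.1 < n
    · obtain ⟨j, h1, h2, h3⟩ := ih (x.1 + d, x.2 + 1) (by simpa [add_assoc] using h)
      refine ⟨j + 1, ?_, by simpa [add_assoc] using h2, fun i hi => ?_⟩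
      · rw [List.foldl_cons, slaterStep, if_pos hx, h1]
        simp only
        omega
      · rcases i with _ | i
        · simpa using hx
        · simpa [add_assoc] using h3 i (by omega)
    · exact ⟨0, by rw [foldl_slaterStep_of_le (by omega)]; simp, by simpa using! hx, by simp⟩

/-- The list of the values of `f`, the larger values first. -/
def bucketList {α : Type*} (f : α → ℕ) (l : List α) : ℕ → List ℕ
  | 0 => []
  | t + 1 => (l.filter fun a => f a = t + 1).map f ++ bucketList f l t

theorem mem_bucketList {α : Type*} {f : α → ℕ} {l : List α} {t d : ℕ}
    (h : d ∈ bucketList f l t) : d ≤ t := by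
  induction t with
  | zero => simp [bucketList] at h
  | succ t ih =>
    simp only [bucketList, List.mem_append, List.mem_map, List.mem_filter, decide_eq_true_eq] at h
    rcases h with ⟨a, ⟨_, h⟩, rfl⟩ | h
    · omega
    · exact (ih h).trans (Nat.le_succ t)

theorem pairwise_bucketList {α : Type*} (f : α → ℕ) (l : List α) (t : ℕ) :
    (bucketList f l t).Pairwise (· ≥ ·) := by
  induction t with
  | zero => simp [bucketList]
  | succ t ih =>
    rw [bucketList, List.pairwise_append]
    refine ⟨?_, ih, ?_⟩
    · refine List.pairwise_of_forall_mem_list ?_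
      simp only [List.mem_map, List.mem_filter, decide_eq_true_eq]
      rintro _ ⟨a, ⟨_, ha⟩, rfl⟩ _ ⟨b, ⟨_, hb⟩, rfl⟩
      omega
    · simp only [List.mem_map, List.mem_filter, decide_eq_true_eq]
      rintro _ ⟨a, ⟨_, ha⟩, rfl⟩ d hd
      have := mem_bucketList hd
      omega

theorem count_bucketList {α : Type*} (f : α → ℕ) (l : List α) (t d : ℕ) :
    (bucketList f l t).count d = if 1 ≤ d ∧ d ≤ t then (l.map f).count d else 0 := by
  induction t with
  | zero => rw [if_neg (by omega)]; rfl
  | succ t ih =>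
    rw [bucketList, List.count_append, ih]
    have : ((l.filter fun a => f a = t + 1).map f).count d =
        if d = t + 1 then (l.map f).count d else 0 := by
      clear ih
      induction l with
      | nil => simp
      | cons a l ih =>
        rw [List.filter_cons]
        by_cases h : f a = t + 1
        · rw [if_pos (by simpa using h), List.map_cons, List.map_cons, List.count_cons,
            List.count_cons, ih, h]
          grind
        · rw [if_neg (by simpa using h), ih, List.map_cons, List.count_cons]
          grind
    rw [this]
    split_ifs <;> omega

theorem bucketList_perm {α : Type*} {f : α → ℕ} {l : List α} {t : ℕ}
    (h : ∀ a ∈ l, 1 ≤ f a ∧ f a ≤ t) : (bucketList f l t).Perm (l.map f) := by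
  rw [List.perm_iff_count]
  intro d
  rw [count_bucketList]
  split_ifs with hd
  · rfl
  · symm
    rw [List.count_eq_zero, List.mem_map]
    rintro ⟨a, ha, rfl⟩
    exact hd (h a ha)

section slater

variable {V : Type*} [Fintype V] [DecidableEq V] (G : SimpleGraph V)

/-- Thus the routine computing gains also provides the terms d + 1 of the Slater number. -/
theorem gain_empty (v : V) [Fintype (G.neighborSet v)] : G.gain ∅ v = G.degree v + 1 := by
  have : G.closedNbhd v = insert v (G.neighborFinset v) := by
    ext u
    simp [mem_closedNbhd]
  rw [gain, Finset.sdiff_empty, this, Finset.card_insert_of_notMem (by simp),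
    card_neighborFinset_eq_degree]

/-- Two non-increasing lists that are permutations of each other coincide. No vertex is lost in the
buckets, because a closed neighborhood has between 1 and n elements. -/
theorem map_degreeSeq {l : List V} (hl : (l : Multiset V) = Finset.univ.val) :
    G.degreeSeq.map (fun d => d + 1) = bucketList (G.gain ∅) l (Fintype.card V) := by
  classical
  refine List.Perm.eq_of_pairwise' (r := (· ≥ ·)) ?_ (pairwise_bucketList _ _ _) ?_
  · rw [List.pairwise_map]
    refine List.Pairwise.imp ?_ (Multiset.pairwise_sort _ _)
    intro a b h
    exact Nat.succ_le_succ h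
  · have h1 : (bucketList (G.gain ∅) l (Fintype.card V)).Perm (l.map (G.gain ∅)) := by
      refine bucketList_perm fun v _ => ⟨?_, Finset.card_le_univ _⟩
      rw [gain_empty]
      omega
    refine List.Perm.trans ?_ h1.symm
    rw [← Multiset.coe_eq_coe, ← Multiset.map_coe, ← Multiset.map_coe, hl, degreeSeq,
      Multiset.sort_eq, Multiset.map_map]
    refine Multiset.map_congr rfl fun v _ => ?_
    rw [gain_empty, Function.comp_apply]

/-- The Slater number is computed by a counting sort of the vertices by degree. -/
theorem foldl_slaterStep_bucketList {l : List V} (hl : (l : Multiset V) = Finset.univ.val)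
    (hV : 1 ≤ Fintype.card V) :
    ((bucketList (G.gain ∅) l (Fintype.card V)).foldl (slaterStep (Fintype.card V)) (0, 0)).2 =
      G.slaterNumber ∧ 1 ≤ G.slaterNumber ∧ G.slaterNumber ≤ Fintype.card V := by
  classical
  set n := Fintype.card V
  set L := bucketList (G.gain ∅) l n
  have hL : G.degreeSeq.map (fun d => d + 1) = L := G.map_degreeSeq hl
  have hset : ∀ s, ((G.degreeSeq.take s).map fun d => d + 1) = L.take s := fun s => by
    rw [← hL, List.map_take]
  have hlen : L.length = n := by
    rw [← hL, List.length_map, degreeSeq, Multiset.length_sort, Multiset.card_map]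
    rfl
  -- All n entries are at least 1.
  have hsum : n ≤ L.sum := by
    have := List.card_nsmul_le_sum L 1 (fun d hd => by
      rw [← hL, List.mem_map] at hd
      obtain ⟨e, _, rfl⟩ := hd
      omega)
    simpa [hlen] using this
  obtain ⟨j, h1, h2, h3⟩ := foldl_slaterStep (n := n) L (0, 0) (by simpa using hsum)
  simp only [zero_add] at h1 h2 h3
  have hj : 1 ≤ j := by
    by_contra! h
    obtain rfl : j = 0 := by omega
    simp at h2
    omega
  have hj' : j = G.slaterNumber := by
    refine le_antisymm ?_ (Nat.sInf_le ⟨hj, by rwa [hset]⟩)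
    refine le_csInf ⟨j, hj, by rwa [hset]⟩ fun s hs => ?_
    by_contra! h
    have := hs.2
    rw [hset] at this
    exact absurd (h3 s h) (by omega)
  have hn : G.slaterNumber ≤ n := Nat.sInf_le ⟨hV, by
    rw [hset, List.take_of_length_le hlen.le]; exact hsum⟩
  exact ⟨h1.trans hj', hj' ▸ hj, hn⟩

end slater

end SimpleGraph

/-! ### The counter program -/

namespace CounterProg

/-! ### Loop rule, frame rule and counter arithmetic -/

section basic

variable {ρ : Type} [DecidableEq ρ]

/-- Whether a program may change a counter. -/
def writes : CounterProg ρ → ρ → Bool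
  | .nop, _ => false
  | .inc x, r => decide (r = x)
  | .dec x, r => decide (r = x)
  | .clr x, r => decide (r = x)
  | .ifZero _ p q, r => writes p r || writes q r
  | .test _ _ p q, r => writes p r || writes q r
  | .upd _ _, _ => false
  | .rep _ p, r => writes p r
  | .seq p q, r => writes p r || writes q r

/-- The invariant rule for `rep`: `P k` describes the memory after `k` rounds. -/
theorem iterate_induction {α : Type*} {F : α → α} (P : ℕ → α → Prop) {N : ℕ}
    (h : ∀ k < N, ∀ m, P k m → P (k + 1) (F m)) {m : α} (h₀ : P 0 m) : P N (F^[N] m) := by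
  induction N with
  | zero => exact h₀
  | succ N ih =>
    rw [Function.iterate_succ_apply']
    exact h N (Nat.lt_succ_self N) _ (ih fun k hk => h k (hk.trans (Nat.lt_succ_self N)))

/-- A frame rule whose hypothesis is settled by `decide` for concrete programs. -/
theorem reg_run_of_writes_eq_false {p : CounterProg ρ} {r : ρ} (h : writes p r = false)
    (m : CounterMem ρ) : (run p m).reg r = m.reg r := by
  induction p generalizing m with
  | nop => rfl
  | inc x => exact Function.update_of_ne (by simpa [writes] using h) _ _
  | dec x => exact Function.update_of_ne (by simpa [writes] using h) _ _
  | clr x => exact Function.update_of_ne (by simpa [writes] using h) _ _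
  | upd x f => rfl
  | ifZero x p q ihp ihq =>
    simp only [writes, Bool.or_eq_false_iff] at h
    rw [run]
    split_ifs
    · exact ihp h.1 m
    · exact ihq h.2 m
  | test x b p q ihp ihq =>
    simp only [writes, Bool.or_eq_false_iff] at h
    rw [run]
    split_ifs
    · exact ihp h.1 m
    · exact ihq h.2 m
  | seq p q ihp ihq =>
    simp only [writes, Bool.or_eq_false_iff] at h
    rw [run, ihq h.2, ihp h.1]
  | rep x p ih =>
    rw [run]
    exact iterate_induction (fun _ m' => m'.reg r = m.reg r) (fun k _ m' hm' => (ih h m').trans hm')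
      rfl

/-- Add the counter `y` to the counter `x`. -/
def add (x y : ρ) : CounterProg ρ := .rep y (.inc x)

/-- Subtract the counter `y` from the counter `x`. -/
def sub (x y : ρ) : CounterProg ρ := .rep y (.dec x)

/-- Compare the counters `x` and `y`, using the scratch counter `z`. -/
def ifLe (z x y : ρ) (p q : CounterProg ρ) : CounterProg ρ :=
  .seq (.clr z) <| .seq (add z x) <| .seq (sub z y) <| .ifZero z p q

/-- Set the counter `z` to the product of `x` and `y`. -/
def setMul (z x y : ρ) : CounterProg ρ := .seq (.clr z) (.rep x (add z y))

theorem run_add (x y : ρ) (m : CounterMem ρ) : run (add x y) m =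
    ⟨Function.update m.reg x (m.reg x + min (m.reg y) m.arr.length), m.arr⟩ := by
  rw [add, run]
  exact iterate_induction
    (fun k (m' : CounterMem _) => m' = ⟨Function.update m.reg x (m.reg x + k), m.arr⟩)
    (fun k _ m' hm' => by simp [hm', run, add_assoc]) (by simp)

theorem run_sub (x y : ρ) (m : CounterMem ρ) : run (sub x y) m =
    ⟨Function.update m.reg x (m.reg x - min (m.reg y) m.arr.length), m.arr⟩ := by
  rw [sub, run]
  exact iterate_induction
    (fun k (m' : CounterMem _) => m' = ⟨Function.update m.reg x (m.reg x - k), m.arr⟩)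
    (fun k _ m' hm' => by simp [hm', run, Nat.sub_sub]) (by simp)

/-- The truncated difference x - y vanishes iff x ≤ y. Capping y at the array length does no harm as
long as x is below the cap. -/
theorem run_ifLe {z x y : ρ} (hx : x ≠ z) (hy : y ≠ z) (p q : CounterProg ρ) {m : CounterMem ρ}
    (hm : m.reg x ≤ m.arr.length) : run (ifLe z x y p q) m =
      run (if m.reg x ≤ m.reg y then p else q)
        ⟨Function.update m.reg z (m.reg x - min (m.reg y) m.arr.length), m.arr⟩ := by
  have : m.reg x - min (m.reg y) m.arr.length = 0 ↔ m.reg x ≤ m.reg y := by omega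
  simp only [ifLe, run, run_add, run_sub, Function.update_self, Function.update_idem,
    Function.update_of_ne hx, Function.update_of_ne hy, min_eq_left hm, zero_add, this]
  split_ifs <;> rfl

theorem run_setMul {z x y : ρ} (hx : x ≠ z) (hy : y ≠ z) {m : CounterMem ρ}
    (hxm : m.reg x ≤ m.arr.length) (hym : m.reg y ≤ m.arr.length) : run (setMul z x y) m =
      ⟨Function.update m.reg z (m.reg x * m.reg y), m.arr⟩ := by
  simp only [setMul, run, Function.update_of_ne hx, min_eq_left hxm]
  refine iterate_induction
    (fun k (m' : CounterMem _) => m' = ⟨Function.update m.reg z (k * m.reg y), m.arr⟩)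
    (fun k _ m' hm' => ?_) (by simp)
  simp [hm', run_add, Function.update_of_ne hy, min_eq_left hym, Nat.succ_mul]

end basic

/-! ### The algorithm as a counter program -/

/-- The counters of the program deciding about the domination number. -/
inductive Reg : Type
  | n | s | tot | t | v | j | p | g | u | q | z
deriving DecidableEq

instance : Fintype Reg :=
  ⟨{.n, .s, .tot, .t, .v, .j, .p, .g, .u, .q, .z}, fun x => by cases x <;> decide⟩

/-- Set the counter `p` to the position at which row `v` of the adjacency matrix starts. -/
def seekRow : CounterProg Reg := .seq (.clr .p) (.rep .v (.seq (add .p .n) (.inc .p)))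

/-- Run a program for each vertex `j` in the closed neighborhood of the vertex `v`. -/
def forNbrs (c : CounterProg Reg) : CounterProg Reg :=
  .seq (.clr .j) <| .seq (add .j .v) <| .seq c <| .seq (.clr .j) <| .seq seekRow <|
    .rep .n <| .seq (.test .p (fun e => e.1 == some true) c .nop) <| .seq (.inc .p) (.inc .j)

/-- Set the counter `g` to the number of unmarked vertices dominated by `v`. -/
def computeGain : CounterProg Reg :=
  .seq (.clr .g) (forNbrs (.test .j Prod.snd .nop (.inc .g)))

/-- Mark the vertices dominated by `v`. -/
def markNbrs : CounterProg Reg := forNbrs (.upd .j fun e => (e.1, true))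

/-- Count the vertex `v` for the Slater number if its degree is the counter `t` minus one. -/
def slaterBody : CounterProg Reg :=
  .seq computeGain <| .seq
    (ifLe .z .g .t (ifLe .z .t .g
      (ifLe .z .n .tot .nop (.seq (add .tot .t) (.inc .s))) .nop) .nop) (.inc .v)

/-- Set the counter `s` to the Slater number. -/
def computeSlater : CounterProg Reg :=
  .seq (add .t .n) (.rep .n (.seq (.seq (.clr .v) (.rep .n slaterBody)) (.dec .t)))

/-- Select the vertex `v` if this is worthwhile. -/
def greedyBody : CounterProg Reg :=
  .seq computeGain <| .seq (setMul .q .s .g) <|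
    .seq (ifLe .z .u .q (.seq markNbrs (sub .u .g)) .nop) (.inc .v)

/-- Pass repeatedly over all vertices; the counter `u` is the number of unmarked vertices. -/
def greedyPasses : CounterProg Reg :=
  .seq (add .u .n) (.rep .n (.seq (.clr .v) (.rep .n greedyBody)))

/-- The program deciding about the domination number. -/
def decideDomination : CounterProg Reg := .seq computeSlater greedyPasses

/-! ### Correctness of the subroutines -/

variable {n : ℕ} {G : SimpleGraph (Fin n)}

open Classical in
/-- The memory holds the adjacency matrix of `G`, and the vertices in `D` are marked. -/
structure Encodes (G : SimpleGraph (Fin n)) (D : Finset (Fin n)) (m : CounterMem Reg) : Prop where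
  length_arr : m.arr.length = n * (n + 1)
  reg_n : m.reg .n = n
  adj : ∀ i j : Fin n, ∃ b, m.arr[(i : ℕ) * (n + 1) + j]? = some (some (decide (G.Adj i j)), b)
  mark : ∀ j : Fin n, ∃ e, m.arr[(j : ℕ)]? = some (e, decide (j ∈ D))

theorem Encodes.of_eq {D : Finset (Fin n)} {m m' : CounterMem Reg} (h : Encodes G D m)
    (ha : m'.arr = m.arr) (hn : m'.reg .n = m.reg .n) : Encodes G D m' :=
  ⟨ha ▸ h.length_arr, hn.trans h.reg_n, ha ▸ h.adj, ha ▸ h.mark⟩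

/-- Since n ≤ n(n + 1), the cap on loops is inactive for counters up to n. -/
theorem Encodes.le_length {D : Finset (Fin n)} {m : CounterMem Reg} (h : Encodes G D m) {k : ℕ}
    (hk : k ≤ n) : k ≤ m.arr.length := by
  rw [h.length_arr]
  nlinarith

theorem Encodes.run_seekRow {D : Finset (Fin n)} {m : CounterMem Reg} (h : Encodes G D m)
    (hv : m.reg .v ≤ n) : run seekRow m =
      ⟨Function.update m.reg .p (m.reg .v * (n + 1)), m.arr⟩ := by
  have h1 := h.le_length hv
  have h2 := h.le_length le_rfl
  simp only [seekRow, run, Function.update_of_ne (show Reg.v ≠ Reg.p by decide), min_eq_left h1]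
  refine iterate_induction
    (fun k (m' : CounterMem _) => m' = ⟨Function.update m.reg .p (k * (n + 1)), m.arr⟩)
    (fun k _ m' hm' => ?_) (by simp)
  simp [hm', run_add, h.reg_n, min_eq_left h2, Nat.succ_mul, add_assoc]

/-- In `I S m`, the set `S` consists of the vertices already visited. `hcongr` makes `I` insensitive
to the counters `j` and `p` that the traversal itself changes, and `i ∉ S` in `hc` says that no
vertex is visited twice, as counting requires. -/
theorem run_forNbrs {c : CounterProg Reg} (hcv : writes c .v = false) (hcj : writes c .j = false)
    (hcp : writes c .p = false) (I : Finset (Fin n) → CounterMem Reg → Prop)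
    (hI : ∀ S m, I S m → ∃ D, Encodes G D m)
    (hcongr : ∀ S m m', I S m → m'.arr = m.arr → (∀ r, r ≠ .j → r ≠ .p → m'.reg r = m.reg r) →
      I S m')
    (hc : ∀ S m (i : Fin n), I S m → m.reg .j = i → i ∉ S → I (insert i S) (run c m))
    {m : CounterMem Reg} {i : Fin n} (h : I ∅ m) (hv : m.reg .v = i) :
    I (G.closedNbhd i) (run (forNbrs c) m) := by
  classical
  obtain ⟨D, hD⟩ := hI _ _ h
  set m₁ : CounterMem Reg := ⟨Function.update m.reg .j i, m.arr⟩ with hm₁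
  have e₁ : run (add .j .v) (run (.clr .j) m) = m₁ := by
    simp [run, run_add, hv, hm₁, min_eq_left (hD.le_length i.2.le)]
  have h₁ : I {i} (run c m₁) :=
    hc ∅ m₁ i (hcongr _ _ _ h rfl fun r hj _ => by simp [hm₁, hj]) (by simp [hm₁]) (by simp)
  set m₂ := run c m₁ with hm₂
  have hv₂ : m₂.reg .v = i := by
    rw [hm₂, reg_run_of_writes_eq_false hcv]
    simpa [hm₁] using hv
  set m₃ : CounterMem Reg := ⟨Function.update m₂.reg .j 0, m₂.arr⟩ with hm₃
  have h₃ : I {i} m₃ := hcongr _ _ _ h₁ rfl fun r hj _ => by simp [hm₃, hj]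
  have hv₃ : m₃.reg .v = i := by simpa [hm₃] using hv₂
  obtain ⟨D₃, hD₃⟩ := hI _ _ h₃
  have e₄ := hD₃.run_seekRow (by rw [hv₃]; exact i.2.le)
  rw [hv₃] at e₄
  have e : run (forNbrs c) m = (run (.seq (.test .p (fun e => e.1 == some true) c .nop)
      (.seq (.inc .p) (.inc .j))))^[n] (run seekRow m₃) := by
    rw [e₄]
    have hn : m₃.reg .n = n := hD₃.reg_n
    have hl := hD₃.le_length le_rfl
    have : run (forNbrs c) m = run (.rep .n <| .seq (.test .p (fun e => e.1 == some true) c .nop)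
      (.seq (.inc .p) (.inc .j))) (run seekRow (run (.clr .j) (run c
        (run (add .j .v) (run (.clr .j) m))))) := rfl
    rw [this, e₁, ← hm₂]
    change run (.rep .n _) (run seekRow m₃) = _
    rw [e₄, run]
    simp [hn, min_eq_left hl]
  rw [e, e₄]
  -- The row of `i` starts at `i * (n + 1)`, each row being followed by a separator.
  have key := iterate_induction (F := run (.seq (.test .p (fun e => e.1 == some true) c .nop)
      (.seq (.inc .p) (.inc .j)))) (N := n)
    (fun k m' => I (insert i ({j | (j : ℕ) < k ∧ G.Adj i j} : Finset (Fin n))) m' ∧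
      m'.reg .j = k ∧ m'.reg .p = i * (n + 1) + k) ?_
    (m := ⟨Function.update m₃.reg .p (i * (n + 1)), m₃.arr⟩) ?_
  · have hS : insert i ({j | (j : ℕ) < n ∧ G.Adj i j} : Finset (Fin n)) = G.closedNbhd i := by
      ext u
      simp [SimpleGraph.mem_closedNbhd]
    rw [hS] at key
    exact key.1
  · rintro k hk m' ⟨hI', hj', hp'⟩
    obtain ⟨D', hD'⟩ := hI _ _ hI'
    obtain ⟨b, hb⟩ := hD'.adj i ⟨k, hk⟩
    have hfin : ∀ S m'', I S m'' → m''.reg .j = k → m''.reg .p = i * (n + 1) + k →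
        I S (run (.seq (.inc .p) (.inc .j)) m'') ∧
        (run (.seq (.inc .p) (.inc .j)) m'').reg .j = k + 1 ∧
        (run (.seq (.inc .p) (.inc .j)) m'').reg .p = i * (n + 1) + (k + 1) := by
      intro S m'' h hj hp
      refine ⟨hcongr _ _ _ h rfl fun r hj hp => ?_, ?_, ?_⟩
      · simp [run, hj, hp]
      · simp [run, hj]
      · simp [run, hp, add_assoc]
    rw [run, run, hp', hb]
    by_cases ha : G.Adj i ⟨k, hk⟩
    · have hS : insert i ({j | (j : ℕ) < k + 1 ∧ G.Adj i j} : Finset (Fin n)) =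
          insert ⟨k, hk⟩ (insert i ({j | (j : ℕ) < k ∧ G.Adj i j} : Finset (Fin n))) := by
        ext u
        simp only [Finset.mem_insert, Finset.mem_filter, Finset.mem_univ, true_and, Fin.ext_iff]
        constructor
        · rintro (h | ⟨h1, h2⟩)
          · exact .inr (.inl h)
          · rcases Nat.lt_succ_iff_lt_or_eq.1 h1 with h | h
            · exact .inr (.inr ⟨h, h2⟩)
            · exact .inl h
        · rintro (h | h | ⟨h1, h2⟩)
          · obtain rfl : u = ⟨k, hk⟩ := Fin.ext h
            exact .inr ⟨Nat.lt_succ_self k, ha⟩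
          · exact .inl h
          · exact .inr ⟨h1.trans (Nat.lt_succ_self k), h2⟩
      -- Irreflexivity of adjacency: `i` itself was visited before the row was read.
      have hnot : (⟨k, hk⟩ : Fin n) ∉
          insert i ({j | (j : ℕ) < k ∧ G.Adj i j} : Finset (Fin n)) := by
        simpa using ha.ne'
      rw [hS, if_pos (by simp [ha])]
      refine hfin _ _ (hc _ _ _ hI' hj' hnot) ?_ ?_
      · rw [reg_run_of_writes_eq_false hcj, hj']
      · rw [reg_run_of_writes_eq_false hcp, hp']
    · have hS : insert i ({j | (j : ℕ) < k + 1 ∧ G.Adj i j} : Finset (Fin n)) =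
          insert i ({j | (j : ℕ) < k ∧ G.Adj i j} : Finset (Fin n)) := by
        congr 1
        ext u
        simp only [Finset.mem_filter, Finset.mem_univ, true_and]
        constructor
        · rintro ⟨h1, h2⟩
          rcases Nat.lt_succ_iff_lt_or_eq.1 h1 with h | h
          · exact ⟨h, h2⟩
          · obtain rfl : u = ⟨k, hk⟩ := Fin.ext h
            exact absurd h2 ha
        · rintro ⟨h1, h2⟩
          exact ⟨h1.trans (Nat.lt_succ_self k), h2⟩
      rw [hS, if_neg (by simp [ha])]
      exact hfin _ _ hI' hj' hp'
  · refine ⟨?_, by simp [hm₃], by simp⟩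
    have : ({j | (j : ℕ) < 0 ∧ G.Adj i j} : Finset (Fin n)) = ∅ := by simp
    rw [this]
    exact hcongr _ _ _ h₃ rfl fun r _ hp => by simp [hp]

theorem Encodes.run_computeGain {D : Finset (Fin n)} {m : CounterMem Reg} (h : Encodes G D m)
    {i : Fin n} (hv : m.reg .v = i) :
    Encodes G D (run computeGain m) ∧ (run computeGain m).reg .g = G.gain D i := by
  rw [computeGain, run]
  refine run_forNbrs (G := G) (by decide) (by decide) (by decide)
    (fun S m => Encodes G D m ∧ m.reg .g = (S \ D).card) (fun S m h => ⟨D, h.1⟩) ?_ ?_ ?_ ?_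
  · rintro S m m' ⟨h1, h2⟩ ha hr
    exact ⟨h1.of_eq ha (hr _ (by decide) (by decide)), (hr _ (by decide) (by decide)).trans h2⟩
  · rintro S m i ⟨h1, h2⟩ hj hi
    obtain ⟨e, he⟩ := h1.mark i
    rw [run, hj, he]
    by_cases hiD : i ∈ D
    · rw [if_pos (by simp [hiD]), Finset.insert_sdiff_of_mem _ hiD]
      exact ⟨h1, h2⟩
    · rw [if_neg (by simp [hiD]), Finset.insert_sdiff_of_notMem _ hiD,
        Finset.card_insert_of_notMem (by simp [hi])]
      exact ⟨h1.of_eq rfl (by simp [run]), by simp [run, h2]⟩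
  · exact ⟨h.of_eq rfl (by simp [run]), by simp [run]⟩
  · simpa [run] using hv

/-- The mark of vertex `j` is the second component of cell `j`, whatever matrix entry that cell
holds, so marking leaves the matrix intact. -/
theorem Encodes.run_markNbrs {D : Finset (Fin n)} {m : CounterMem Reg} (h : Encodes G D m)
    {i : Fin n} (hv : m.reg .v = i) : Encodes G (D ∪ G.closedNbhd i) (run markNbrs m) := by
  refine run_forNbrs (G := G) (by decide) (by decide) (by decide)
    (fun S m => Encodes G (D ∪ S) m) (fun S m h => ⟨_, h⟩) ?_ ?_ (by simpa using h) hv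
  · intro S m m' h ha hr
    exact h.of_eq ha (hr _ (by decide) (by decide))
  · intro S m i h hj _
    refine ⟨by simpa [run] using h.length_arr, h.reg_n, fun a b => ?_, fun a => ?_⟩
    · obtain ⟨e, he⟩ := h.adj a b
      simp only [run, List.getElem?_modify, he]
      split_ifs
      · exact ⟨true, rfl⟩
      · exact ⟨e, rfl⟩
    · obtain ⟨e, he⟩ := h.mark a
      simp only [run, List.getElem?_modify, he, hj]
      refine ⟨e, ?_⟩
      by_cases hai : a = i
      · simp [hai]
      · have : ¬ (i : ℕ) = a := fun h => hai (Fin.ext h.symm)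
        simp [this, hai]

end CounterProg

/-! ### Correctness of the Slater computation and of the greedy passes -/

namespace CounterProg

variable {n : ℕ} {G : SimpleGraph (Fin n)}

theorem run_seq {ρ : Type} [DecidableEq ρ] (p q : CounterProg ρ) (m : CounterMem ρ) :
    run (.seq p q) m = run q (run p m) := rfl

theorem take_succ_finRange {k : ℕ} (hk : k < n) :
    (List.finRange n).take (k + 1) = (List.finRange n).take k ++ [⟨k, hk⟩] := by
  rw [List.take_add_one]
  simp [hk]

/-- A loop over all vertices computes a fold. -/
theorem run_forVertices {c : CounterProg Reg} {α : Type*} {f : α → Fin n → α}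
    {I : α → CounterMem Reg → Prop} (hI : ∀ a m, I a m → ∃ D, Encodes G D m)
    (hcongr : ∀ a m, I a m → I a (run (.clr .v) m))
    (hc : ∀ a m (i : Fin n), I a m → m.reg .v = i →
      I (f a i) (run c m) ∧ (run c m).reg .v = i + 1)
    {a : α} {m : CounterMem Reg} (h : I a m) :
    I ((List.finRange n).foldl f a) (run (.seq (.clr .v) (.rep .n c)) m) := by
  have h₁ := hcongr _ _ h
  obtain ⟨D, hD⟩ := hI _ _ h₁
  have key := iterate_induction (F := run c) (N := n)
    (fun k m' => I (((List.finRange n).take k).foldl f a) m' ∧ m'.reg .v = k) ?_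
    (m := run (.clr .v) m) ⟨by simpa using h₁, by simp [run]⟩
  · rw [run_seq, show ∀ m, run (.rep .n c) m = (run c)^[min (m.reg .n) m.arr.length] m from
      fun _ => rfl, hD.reg_n, min_eq_left (hD.le_length le_rfl)]
    rw [List.take_of_length_le (by simp)] at key
    exact key.1
  · rintro k hk m' ⟨h, hv⟩
    rw [take_succ_finRange hk, List.foldl_append]
    exact hc _ _ ⟨k, hk⟩ h hv

theorem run_slaterBody {t : ℕ} {x : ℕ × ℕ} {m : CounterMem Reg} {i : Fin n} (h : Encodes G ∅ m)
    (htot : m.reg .tot = x.1) (hs : m.reg .s = x.2) (ht : m.reg .t = t) (htn : t ≤ n)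
    (hv : m.reg .v = i) :
    (Encodes G ∅ (run slaterBody m) ∧
      (run slaterBody m).reg .tot =
        (if G.gain ∅ i = t then SimpleGraph.slaterStep n x t else x).1 ∧
      (run slaterBody m).reg .s =
        (if G.gain ∅ i = t then SimpleGraph.slaterStep n x t else x).2 ∧
      (run slaterBody m).reg .t = t) ∧ (run slaterBody m).reg .v = i + 1 := by
  obtain ⟨h₁, hg⟩ := h.run_computeGain hv
  have hgn : G.gain ∅ i ≤ n := (Finset.card_le_univ _).trans_eq (Fintype.card_fin n)
  have hr : ∀ r, writes computeGain r = false → (run computeGain m).reg r = m.reg r :=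
    fun r hr => reg_run_of_writes_eq_false hr m
  -- Comparisons change only the scratch counter `z`, to which `P` is insensitive, so the memory can
  -- be generalized after each of the three tests.
  set P : CounterMem Reg → Prop := fun m => Encodes G ∅ m ∧ m.reg .tot = x.1 ∧ m.reg .s = x.2 ∧
    m.reg .t = t ∧ m.reg .g = G.gain ∅ i ∧ m.reg .v = i with hP
  have h₂ : P (run computeGain m) :=
    ⟨h₁, (hr .tot (by decide)).trans htot, (hr .s (by decide)).trans hs,
      (hr .t (by decide)).trans ht, hg, (hr .v (by decide)).trans hv⟩
  have hz : ∀ {m} w, P m → P ⟨Function.update m.reg .z w, m.arr⟩ := by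
    rintro m w ⟨h₁, h₂⟩
    exact ⟨h₁.of_eq rfl (by simp), by simpa using h₂⟩
  have hnop : ∀ {m}, P m → (Encodes G ∅ (run (.inc .v) m) ∧ (run (.inc .v) m).reg .tot = x.1 ∧
      (run (.inc .v) m).reg .s = x.2 ∧ (run (.inc .v) m).reg .t = t) ∧
      (run (.inc .v) m).reg .v = i + 1 := by
    rintro m ⟨h₁, h₂, h₃, h₄, -, h₆⟩
    exact ⟨⟨h₁.of_eq rfl (by simp [run]), by simp [run, h₂], by simp [run, h₃], by simp [run, h₄]⟩,
      by simp [run, h₆]⟩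
  have hg' : ∀ {m}, P m → m.reg .g = G.gain ∅ i := fun h => h.2.2.2.2.1
  have ht' : ∀ {m}, P m → m.reg .t = t := fun h => h.2.2.2.1
  have htot' : ∀ {m}, P m → m.reg .tot = x.1 := fun h => h.2.1
  rw [slaterBody, run_seq, run_seq]
  generalize run computeGain m = m₁ at h₂
  rw [run_ifLe (by decide) (by decide) _ _ (by rw [hg' h₂]; exact h₂.1.le_length hgn), hg' h₂,
    ht' h₂]
  by_cases hgt : G.gain ∅ i ≤ t
  swap
  · rw [if_neg hgt, if_neg (by omega)]
    exact hnop (hz _ h₂)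
  rw [if_pos hgt]
  replace h₂ := hz (G.gain ∅ i - min t m₁.arr.length) h₂
  generalize CounterMem.mk _ _ = m₂ at h₂ ⊢
  rw [run_ifLe (by decide) (by decide) _ _ (by rw [ht' h₂]; exact h₂.1.le_length htn), hg' h₂,
    ht' h₂]
  by_cases htg : t ≤ G.gain ∅ i
  swap
  · rw [if_neg htg, if_neg (by omega)]
    exact hnop (hz _ h₂)
  rw [if_pos htg, if_pos (le_antisymm hgt htg)]
  replace h₂ := hz (t - min (G.gain ∅ i) m₂.arr.length) h₂
  generalize CounterMem.mk _ _ = m₃ at h₂ ⊢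
  rw [run_ifLe (by decide) (by decide) _ _ (by rw [h₂.1.reg_n]; exact h₂.1.le_length le_rfl),
    h₂.1.reg_n, htot' h₂, SimpleGraph.slaterStep]
  by_cases hx : n ≤ x.1
  · rw [if_pos hx, if_neg (by omega)]
    exact hnop (hz _ h₂)
  rw [if_neg hx, if_pos (by omega)]
  replace h₂ := hz (n - min x.1 m₃.arr.length) h₂
  generalize CounterMem.mk _ _ = m₄ at h₂ ⊢
  obtain ⟨h₁, h₃, h₄, h₅, -, h₆⟩ := h₂
  rw [run_seq, run_add, h₅, min_eq_left (h₁.le_length htn)]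
  exact ⟨⟨h₁.of_eq rfl (by simp [run]), by simp [run, h₃], by simp [run, h₄], by simp [run, h₅]⟩,
    by simp [run, h₆]⟩

theorem foldl_ite_eq {α β : Type*} (f : α → ℕ) (step : β → ℕ → β) (t : ℕ) (l : List α) (x : β) :
    l.foldl (fun x a => if f a = t then step x t else x) x =
      ((l.filter fun a => f a = t).map f).foldl step x := by
  induction l generalizing x with
  | nil => rfl
  | cons a l ih =>
    by_cases h : f a = t
    · simp [h, ih]
    · simp [h, ih]

/-- Counting sort without storing the list: `t` descends from n, and each pass over the vertices
feeds the bucket of value `t` into the fold. The invariant is that folding the remaining buckets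
from the current state still yields the Slater number. -/
theorem run_computeSlater (hn : 1 ≤ n) {m : CounterMem Reg} (h : Encodes G ∅ m)
    (h₀ : ∀ r, r ≠ .n → m.reg r = 0) :
    Encodes G ∅ (run computeSlater m) ∧ (run computeSlater m).reg .s = G.slaterNumber := by
  have hsl := (G.foldl_slaterStep_bucketList (l := List.finRange n) rfl (by simpa using hn)).1
  rw [Fintype.card_fin] at hsl
  rw [computeSlater, run_seq, run_add, h.reg_n, h₀ .t (by decide), min_eq_left (h.le_length le_rfl),
    run]
  simp only [ne_eq, reduceCtorEq, not_false_eq_true, Function.update_of_ne, h.reg_n,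
    min_eq_left (h.le_length le_rfl), zero_add]
  have key := iterate_induction (F := run (.seq (.seq (.clr .v)
    (.rep .n slaterBody)) (.dec .t))) (N := n) (fun k (m' : CounterMem Reg) =>
    ∃ x, Encodes G ∅ m' ∧ m'.reg .tot = x.1 ∧ m'.reg .s = x.2 ∧ m'.reg .t = n - k ∧
      ((SimpleGraph.bucketList (G.gain ∅) (List.finRange n) (n - k)).foldl
        (SimpleGraph.slaterStep n) x).2 = G.slaterNumber)
      (fun k hk m' hm' => ?_) (m := ⟨Function.update m.reg .t n, m.arr⟩)
      ⟨(0, 0), h.of_eq rfl (by simp), by simp [h₀], by simp [h₀], by simp, hsl⟩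
  · obtain ⟨x, h₁, -, hs, -, hx⟩ := key
    refine ⟨h₁, hs.trans ?_⟩
    rw [← hx, Nat.sub_self]
    rfl
  · obtain ⟨x, h₁, h₂, h₃, h₄, h₅⟩ := hm'
    obtain ⟨t, ht⟩ : ∃ t, n - k = t + 1 := ⟨n - k - 1, by omega⟩
    have := run_forVertices (G := G) (c := slaterBody)
      (f := fun x i => if G.gain ∅ i = t + 1 then SimpleGraph.slaterStep n x (t + 1) else x)
      (I := fun x m => Encodes G ∅ m ∧ m.reg .tot = x.1 ∧ m.reg .s = x.2 ∧ m.reg .t = t + 1)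
      (fun x m h => ⟨_, h.1⟩)
      (fun x m h => ⟨h.1.of_eq rfl (by simp [run]), by simpa [run] using h.2⟩)
      (fun x m i h hv => run_slaterBody h.1 h.2.1 h.2.2.1 h.2.2.2 (by omega) hv)
      (a := x) (m := m') ⟨h₁, h₂, h₃, by omega⟩
    rw [foldl_ite_eq] at this
    obtain ⟨h₁, h₂, h₃, h₄⟩ := this
    rw [run_seq]
    refine ⟨_, h₁.of_eq rfl (by simp [run]), h₂, h₃, ?_, ?_⟩
    · generalize run (.seq (.clr .v) (.rep .n slaterBody)) m' = m'' at h₄ ⊢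
      simp only [run, h₄, Function.update_self]
      omega
    · rw [ht, SimpleGraph.bucketList, List.foldl_append] at h₅
      rw [show n - (k + 1) = t by omega]
      exact h₅

/-- The gain is computed before marking and `markNbrs` does not write `g`, so subtracting `g` keeps
`u` equal to the number of unmarked vertices. -/
theorem run_greedyBody {s : ℕ} (hsn : s ≤ n) {D : Finset (Fin n)} {m : CounterMem Reg} {i : Fin n}
    (h : Encodes G D m) (hs : m.reg .s = s) (hu : m.reg .u = n - D.card) (hv : m.reg .v = i) :
    (Encodes G (G.greedyStep s D i) (run greedyBody m) ∧ (run greedyBody m).reg .s = s ∧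
      (run greedyBody m).reg .u = n - (G.greedyStep s D i).card) ∧
      (run greedyBody m).reg .v = i + 1 := by
  obtain ⟨h₁, hg⟩ := h.run_computeGain hv
  have hgn : G.gain D i ≤ n := (Finset.card_le_univ _).trans_eq (Fintype.card_fin n)
  rw [greedyBody, run]
  have hr : ∀ r, writes computeGain r = false → (run computeGain m).reg r = m.reg r :=
    fun r hr => reg_run_of_writes_eq_false hr m
  replace hu := (hr .u (by decide)).trans hu
  replace hs := (hr .s (by decide)).trans hs
  replace hv := (hr .v (by decide)).trans hv
  generalize run computeGain m = m₁ at *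
  have hl := h₁.le_length hsn
  have hl' := h₁.le_length hgn
  rw [run, run_setMul (by decide) (by decide) (by omega) (by omega), run, run_ifLe (by decide)
    (by decide) _ _ ?_]
  swap
  · have := h₁.le_length (Nat.sub_le n D.card)
    simp [hu]; omega
  simp only [ne_eq, reduceCtorEq, not_false_eq_true, Function.update_of_ne, Function.update_self,
    hu, hs, hg]
  unfold SimpleGraph.greedyStep
  rw [Fintype.card_fin]
  split_ifs with hle
  · generalize hm₂ : (CounterMem.mk _ m₁.arr) = m₂
    have h₂ : Encodes G D m₂ := by subst hm₂; exact h₁.of_eq rfl (by simp)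
    have hv₂ : m₂.reg .v = i := by subst hm₂; simpa using hv
    have hu₂ : m₂.reg .u = n - D.card := by subst hm₂; simpa using hu
    have hs₂ : m₂.reg .s = s := by subst hm₂; simpa using hs
    have hg₂ : m₂.reg .g = G.gain D i := by subst hm₂; simpa using hg
    have h₃ := h₂.run_markNbrs hv₂
    have hr : ∀ r, writes markNbrs r = false → (run markNbrs m₂).reg r = m₂.reg r :=
      fun r hr => reg_run_of_writes_eq_false hr m₂
    replace hu₂ := (hr .u (by decide)).trans hu₂
    replace hs₂ := (hr .s (by decide)).trans hs₂
    replace hv₂ := (hr .v (by decide)).trans hv₂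
    replace hg₂ := (hr .g (by decide)).trans hg₂
    have hl₃ := h₃.le_length hgn
    rw [run_seq, run_sub]
    refine ⟨⟨h₃.of_eq rfl (by simp [run]), by simp [run, hs₂], ?_⟩, by simp [run, hv₂]⟩
    simp [run, hu₂, hg₂, min_eq_left hl₃, SimpleGraph.card_union_closedNbhd, Nat.sub_sub]
  · exact ⟨⟨h₁.of_eq rfl (by simp [run]), by simp [run, hs], by simp [run, hu]⟩, by simp [run, hv]⟩

theorem run_greedyPasses {s : ℕ} (hsn : s ≤ n) {m : CounterMem Reg}
    (h : Encodes G ∅ m) (hs : m.reg .s = s) (hu : m.reg .u = 0) :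
    (run greedyPasses m).reg .u =
      n - ((fun D => (List.finRange n).foldl (G.greedyStep s) D)^[n] ∅).card := by
  rw [greedyPasses, run, run_add]
  have hn := h.reg_n
  have hl := h.le_length le_rfl
  simp only [run, hu, hn, min_eq_left hl, zero_add, ne_eq, reduceCtorEq, not_false_eq_true,
    Function.update_of_ne]
  refine (iterate_induction (fun k (m' : CounterMem Reg) =>
    Encodes G ((fun D => (List.finRange n).foldl (G.greedyStep s) D)^[k] ∅) m' ∧ m'.reg .s = s ∧
      m'.reg .u = n - ((fun D => (List.finRange n).foldl (G.greedyStep s) D)^[k] ∅).card)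
      (fun k _ m' hm' => ?_) ?_).2.2
  · rw [Function.iterate_succ_apply']
    exact run_forVertices (G := G) (c := greedyBody) (f := G.greedyStep s)
      (I := fun D m => Encodes G D m ∧ m.reg .s = s ∧ m.reg .u = n - D.card)
      (fun D m h => ⟨D, h.1⟩) (fun D m h => ⟨h.1.of_eq rfl (by simp [run]), by simp [run, h.2.1],
        by simp [run, h.2.2]⟩)
      (fun D m i h hv => run_greedyBody hsn h.1 h.2.1 h.2.2 hv) hm'
  · exact ⟨h.of_eq rfl (by simp), by simp [hs], by simp⟩

theorem getElem?_flatMap {α β : Type*} {c : ℕ} {f : α → List β} (hf : ∀ a, (f a).length = c)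
    (l : List α) (i j : ℕ) (hj : j < c) (hi : i < l.length) :
    (l.flatMap f)[i * c + j]? = (f l[i])[j]? := by
  induction l generalizing i with
  | nil => simp at hi
  | cons a l ih =>
    rw [List.flatMap_cons]
    rcases i with _ | i
    · rw [List.getElem?_append_left (by rw [hf]; omega)]
      simp
    · have : (i + 1) * c + j = c + (i * c + j) := by ring
      rw [List.getElem?_append_right (by rw [hf]; omega), hf, this, Nat.add_sub_cancel_left,
        ih i (by simpa using hi)]
      simp

/-- Matrix entries are never `none`, so only the one separator per row is counted; this is how the
program learns n. -/
theorem count_none_encodeGraph (G : GraphInstance) : (encodeGraph G).count none = G.1 := by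
  classical
  have : ∀ l : List (Fin G.1), (l.flatMap fun i =>
      ((List.finRange G.1).map fun j => some (decide (G.2.Adj i j))) ++ [none]).count none =
      l.length := by
    intro l
    induction l with
    | nil => rfl
    | cons i l ih =>
      rw [List.flatMap_cons, List.count_append, ih, List.count_append]
      rw [List.count_eq_zero.2 (by simp)]
      simp [add_comm]
  rw [encodeGraph]
  convert this (List.finRange G.1)
  simp

theorem encodes_encodeGraph (G : SimpleGraph (Fin n)) : Encodes G ∅
    ⟨Function.update (fun _ => 0) .n ((encodeGraph ⟨n, G⟩).count none),
      (encodeGraph ⟨n, G⟩).map fun e => (e, false)⟩ where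
  length_arr := by simp [encodeGraph_length]
  reg_n := by simp [count_none_encodeGraph]
  adj i j := by
    refine ⟨false, ?_⟩
    rw [List.getElem?_map, encodeGraph, getElem?_flatMap (c := n + 1) (by simp) _ _ _ (by omega)
      (by simp), List.getElem?_append_left (by simp)]
    simp
  mark j := by
    have : (j : ℕ) < (encodeGraph ⟨n, G⟩).length := by
      rw [encodeGraph_length]
      have := j.2
      simp only
      nlinarith
    exact ⟨(encodeGraph ⟨n, G⟩)[(j : ℕ)], by simp [List.getElem?_eq_getElem this]⟩

end CounterProg

theorem theorem2 :
    ∃ f : GraphInstance → Bool,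
      Nonempty (Turing.TM2ComputableInPolyTime encodeGraph Computability.encodeBool f) ∧
      ∀ (n : ℕ) (_ : 1 ≤ n) (G : SimpleGraph (Fin n)),
        (f ⟨n, G⟩ = true → G.dominationNumber > G.slaterNumber) ∧
        (f ⟨n, G⟩ = false →
          (G.dominationNumber : ℝ) ≤
            ((⌈Real.log ((n : ℝ) / (G.slaterNumber : ℝ))⌉ : ℝ) + 1) * (G.slaterNumber : ℝ)) := by
  classical
  -- The decision function is found by unification: it is true iff the final `u` is nonzero, that
  -- is, iff the greedy passes got stuck.
  refine ⟨_, CounterProg.nonempty_computableInPolyTime CounterProg.decideDomination .n .u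
    (fun _ => rfl), fun n hn G => ?_⟩
  have h₀ := CounterProg.encodes_encodeGraph G
  obtain ⟨h₁, hs⟩ := CounterProg.run_computeSlater hn h₀ fun r hr => by simp [hr]
  obtain ⟨-, hs1, hsn⟩ := G.foldl_slaterStep_bucketList (l := List.finRange n) rfl
    (by simpa using hn)
  rw [Fintype.card_fin] at hsn
  have hu := CounterProg.run_greedyPasses hsn h₁ hs
    -- `computeSlater` does not write `u`, which is therefore still 0.
    (CounterProg.reg_run_of_writes_eq_false (by decide) _)
  have hor := SimpleGraph.iterate_greedy_eq_univ_or (G := G) G.slaterNumber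
    (l := List.finRange n) List.mem_finRange
  have hcl := Finset.card_le_univ
    ((fun D => (List.finRange n).foldl (G.greedyStep G.slaterNumber) D)^[n] ∅)
  rw [Fintype.card_fin] at hor hcl
  simp only [CounterProg.decideDomination, CounterProg.run, decide_eq_true_eq,
    decide_eq_false_iff_not, not_not, hu]
  constructor
  · intro hne
    obtain h | ⟨D, -, hD, hstuck⟩ := hor
    · omega
    · exact SimpleGraph.lt_dominationNumber (by simpa using hD) (by simpa using hstuck)
  · intro he
    have := SimpleGraph.dominationNumber_le_of_greedy (G := G) hs1 (by simpa using hsn)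
      (l := List.finRange n) (k := n) (by rw [Fintype.card_fin]; omega)
    simpa using this
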